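/- Let $H$ be a complex Hilbert space with inner product $\langle\cdot,\cdot\rangle$ antilinear in the first argument, and let $\mathscr S(H)$ be the class of regular, closed, symmetric operators in $H$ with deficiency indices $(1,1)$; regular means that for every $z\in\mathbb C$ there is $d_z>0$ with $\|(A-zI)\varphi\|\ge d_z\|\varphi\|$ for all $\varphi\in\operatorname{dom}(A)$. For an integer $n\ge 0$, an operator $A\in\mathscr S(H)$ is called $n$-entire if there are $\mu_0,\dots,\mu_n\in H$ such that $H=\operatorname{ran}(A-zI)\dotplus\operatorname{span}\{\mu_0+z\mu_1+\dots+z^n\mu_n\}$ for every $z\in\mathbb C$. Let $A\in\mathscr S(H)$ be densely defined. Fix an antilinear isometric involution $J$ that commutes with all canonical selfadjoint extensions of $A$, one such extension $A_\gamma$, a real number $v\notin\operatorname{Sp}(A_\gamma)$ (that is, a point of the spectrum of another canonical selfadjoint extension), a vector $0\ne\psi_v\in\ker(A^*-vI)$ with $J\psi_v=\psi_v$, and a real entire function $h_\gamma$ whose zeros are simple and form the set $\operatorname{Sp}(A_\gamma)$. Let $$\xi(z)=h_\gamma(z)\,\bigl[I+(z-v)(A_\gamma-zI)^{-1}\bigr]\psi_v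 ,$$ continued to the points of $\operatorname{Sp}(A_\gamma)$ by taking limits, and $(\Phi\varphi)(z)=\langle\xi(\bar z),\varphi\rangle$. Transport the inner product of $H$ to $\widehat H=\Phi H$, and let $e$ be any Hermite–Biehler function such that $\widehat H$ is the de Branges space $\mathcal B(e)$, with equal norms. For $n\ge 0$ let $\widehat H_{-n}=\widehat H+z\widehat H+\dots+z^n\widehat H$ with the inner product $\int_{\mathbb R}\overline{f(x)}\,g(x)\,\frac{dx}{(x^2+1)^n|e(x)|^2}$, and let $D:\widehat H_{-n}\to\widehat H$ be the adjoint of the immersion $\widehat H\hookrightarrow\widehat H_{-n}$. Let $\widehat H_{+n}$ be the completion of $D\widehat H$ for the inner product $\langle g,h\rangle_{+n}=\langle g,D^{-1}h\rangle_{\widehat H}$, let $H_{+n}$ be the corresponding space over $H$ (through $\Phi^{-1}$), let $H_{-n}$ be the space of continuous antilinear functionals on $H_{+n}$, and let $[\cdot,\cdot]$ be the duality bracket between $H_{+n}$ and $H_{-n}$. Then, for every integer $n\ge 0$, the canonical continuous map $H_{+n}\to H$ is injective with dense range, $\xi(z)\in H_{+n}$ for every $z\in\mathbb C$, and $A$ is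 $n$-entire if and only if there is $\eta\in H_{-n}$ with $[\xi(z),\eta]\ne 0$ for every $z\in\mathbb C$. Moreover, $A$ is $1$-entire if and only if it is entire in the generalized sense of Krein: $\xi(z)\in H_+$ for every $z\in\mathbb C$ and there is $\mu\in H_-$ with $[\xi(\bar z),\mu]\ne0$ for every $z\in\mathbb C$, where $H_+$ is $\operatorname{dom}(A^*)$ with the graph norm and $H_-$ is the space of continuous antilinear functionals on $H_+$. -/

import Mathlib

open MeasureTheory Filter Topology
open scoped ENNReal NNReal ComplexConjugate

noncomputable section

namespace NEntire

/-! ### Symmetric operators and linear relations -/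

section Operators

variable {H : Type*} [NormedAddCommGroup H] [InnerProductSpace ℂ H]

/-- `ran (A - zI)`. -/
def ranSub (A : H →ₗ.[ℂ] H) (z : ℂ) : Submodule ℂ H :=
  LinearMap.range (A.toFun - z • A.domain.subtype)

/-- The adjoint of a linear relation `B ⊆ H × H`:
`(η, ω) ∈ B*` iff `⟪η, χ⟫ = ⟪ω, φ⟫` for all `(φ, χ) ∈ B`. -/
def adjointRel (B : Submodule ℂ (H × H)) : Submodule ℂ (H × H) where
  carrier := {p | ∀ φ χ : H, (φ, χ) ∈ B → inner ℂ p.1 χ = inner ℂ p.2 φ}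
  zero_mem' := by intro φ χ _; simp
  add_mem' := by
    intro p q hp hq φ χ h
    simp only [Prod.fst_add, Prod.snd_add, inner_add_left, hp φ χ h, hq φ χ h]
  smul_mem' := by
    intro c p hp φ χ h
    simp only [Prod.smul_fst, Prod.smul_snd, inner_smul_left, hp φ χ h]

/-- `Ker (A* - zI)`, where `A*` is the adjoint relation of `A`. -/
def kerAdjointSub (A : H →ₗ.[ℂ] H) (z : ℂ) : Submodule ℂ H where
  carrier := {η | (η, z • η) ∈ adjointRel A.graph}
  zero_mem' := by
    change ((0 : H), z • (0 : H)) ∈ adjointRel A.graph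
    rw [smul_zero]
    exact (adjointRel A.graph).zero_mem
  add_mem' := by
    intro a b ha hb
    have h := (adjointRel A.graph).add_mem ha hb
    rwa [Prod.mk_add_mk, ← smul_add] at h
  smul_mem' := by
    intro c a ha
    have h := (adjointRel A.graph).smul_mem c ha
    rwa [Prod.smul_mk, smul_comm c z a] at h

/-- The class `S(H)` of regular, closed, symmetric operators, densely defined or not,
with deficiency indices `(1,1)`. -/
structure ClassS (A : H →ₗ.[ℂ] H) : Prop where
  closed : A.IsClosed
  symmetric : ∀ φ ψ : A.domain, inner ℂ (A φ) (ψ : H) = inner ℂ (φ : H) (A ψ)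
  regular : ∀ z : ℂ, ∃ d : ℝ, 0 < d ∧ ∀ φ : A.domain, d * ‖(φ : H)‖ ≤ ‖A φ - z • (φ : H)‖
  deficiency_pos : Module.finrank ℂ (kerAdjointSub A Complex.I) = 1
  deficiency_neg : Module.finrank ℂ (kerAdjointSub A (-Complex.I)) = 1

/-- `A` is `n`-entire: `A ∈ S(H)` and there are `μ₀, …, μₙ ∈ H` such that, for all `z ∈ ℂ`,
`H` is the direct sum of `ran (A - zI)` and `span {μ₀ + z μ₁ + ⋯ + zⁿ μₙ}`. -/
def IsNEntire (n : ℕ) (A : H →ₗ.[ℂ] H) : Prop :=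
  ClassS A ∧ ∃ μ : Fin (n + 1) → H, ∀ z : ℂ,
    IsCompl (ranSub A z) (Submodule.span ℂ {∑ k : Fin (n + 1), z ^ (k : ℕ) • μ k})

/-- `B` is a canonical selfadjoint extension of `A`: a selfadjoint linear relation in `H`
that contains the graph of `A`. -/
def IsCanonicalSAExt (A : H →ₗ.[ℂ] H) (B : Submodule ℂ (H × H)) : Prop :=
  A.graph ≤ B ∧ adjointRel B = B

/-- The bounded operator `R`, defined on all of `H`, is `(B - zI)⁻¹` (as relations). -/
def IsResolvent (B : Submodule ℂ (H × H)) (z : ℂ) (R : H →L[ℂ] H) : Prop :=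
  ∀ f g : H, R f = g ↔ (g, f + z • g) ∈ B

/-- The spectrum of a linear relation. -/
def relSpectrum (B : Submodule ℂ (H × H)) : Set ℂ :=
  {z | ¬ ∃ R : H →L[ℂ] H, IsResolvent B z R}

open Classical in
/-- `(B - zI)⁻¹` for `z` outside the spectrum of `B` (and `0` on the spectrum). -/
def relResolvent (B : Submodule ℂ (H × H)) (z : ℂ) : H →L[ℂ] H :=
  if h : ∃ R : H →L[ℂ] H, IsResolvent B z R then h.choose else 0

/-- The antilinear isometry `J` is an involution that commutes with the selfadjoint relation
`B`. -/
def CommutesWith (J : H ≃ₗᵢ⋆[ℂ] H) (B : Submodule ℂ (H × H)) : Prop :=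
  ∀ z : ℂ, z.im ≠ 0 → ∀ φ : H,
    J (relResolvent B z φ) = relResolvent B (conj z) (J φ)

/-- The choices that determine the function `ξ`: an involution `J` commuting with all canonical
selfadjoint extensions of `A`, one such extension `Aγ`, a real `v` outside the spectrum of `Aγ`
(that is, a point of the spectrum of another canonical selfadjoint extension), a nonzero
`ψ ∈ Ker (A* - vI)` with `J ψ = ψ`, and a real entire function `h` whose zeros are all simple
and form the spectrum of `Aγ`. -/
structure XiData (A : H →ₗ.[ℂ] H) where
  J : H ≃ₗᵢ⋆[ℂ] H
  J_involutive : ∀ φ : H, J (J φ) = φ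
  J_commutes : ∀ B : Submodule ℂ (H × H), IsCanonicalSAExt A B → CommutesWith J B
  ext : Submodule ℂ (H × H)
  ext_canonical : IsCanonicalSAExt A ext
  v : ℝ
  v_notMem : (v : ℂ) ∉ relSpectrum ext
  ψ : H
  ψ_ne_zero : ψ ≠ 0
  ψ_mem : ψ ∈ kerAdjointSub A (v : ℂ)
  ψ_real : J ψ = ψ
  h : ℂ → ℂ
  h_entire : Differentiable ℂ h
  h_real : ∀ z : ℂ, h (conj z) = conj (h z)
  h_zeros : ∀ z : ℂ, h z = 0 ↔ z ∈ relSpectrum ext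
  h_simple : ∀ z : ℂ, h z = 0 → deriv h z ≠ 0

/-- `ξ(z) = h(z) [I + (z - v) (Aγ - zI)⁻¹] ψ`, continued to the (isolated) points of the spectrum
of `Aγ` by taking the limit. -/
def XiData.ξ {A : H →ₗ.[ℂ] H} (X : XiData A) (z : ℂ) : H :=
  haveI : Nonempty H := ⟨0⟩
  limUnder (𝓝[≠] z)
    (fun w : ℂ => X.h w • (X.ψ + (w - (X.v : ℂ)) • relResolvent X.ext w X.ψ))

/-- `(Φ φ)(z) = ⟪ξ(z̄), φ⟫`. -/
def XiData.Φ {A : H →ₗ.[ℂ] H} (X : XiData A) : H →ₗ[ℂ] (ℂ → ℂ) where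
  toFun φ := fun z => inner ℂ (X.ξ (conj z)) φ
  map_add' a b := by ext z; simp
  map_smul' c a := by ext z; simp

/-- The function space `Ĥ = Φ H`; its inner product is the one transported from `H` by `Φ`. -/
def XiData.Hhat {A : H →ₗ.[ℂ] H} (X : XiData A) : Submodule ℂ (ℂ → ℂ) :=
  LinearMap.range X.Φ

end Operators

/-! ### De Branges spaces -/

/-- `f^#(z) = conj (f (conj z))`. -/
def sharp (f : ℂ → ℂ) : ℂ → ℂ := fun z => conj (f (conj z))

/-- Hermite–Biehler functions. -/
def IsHermiteBiehler (e : ℂ → ℂ) : Prop :=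
  Differentiable ℂ e ∧ ∀ z : ℂ, 0 < z.im → e z ≠ 0 ∧ ‖sharp e z‖ < ‖e z‖

/-- The Hardy space `H²` of the upper half-plane. -/
def IsHardy (f : ℂ → ℂ) : Prop :=
  DifferentiableOn ℂ f {z : ℂ | 0 < z.im} ∧
    ∃ C : ℝ≥0, ∀ y : ℝ, 0 < y → ∫⁻ x : ℝ, ‖f ((x : ℂ) + (y : ℂ) * Complex.I)‖ₑ ^ 2 ≤ C

/-- The de Branges space `B(e)` as a set of entire functions. -/
def deBrangesSpace (e : ℂ → ℂ) : Set (ℂ → ℂ) :=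
  {f | Differentiable ℂ f ∧ IsHardy (fun z => f z / e z) ∧ IsHardy (fun z => sharp f z / e z)}

/-- The density `1 / ((x² + 1)ⁿ |e(x)|²)`. -/
def weightDensity (e : ℂ → ℂ) (n : ℕ) (x : ℝ) : ℝ≥0∞ :=
  ENNReal.ofReal (1 / ((x ^ 2 + 1) ^ n * ‖e x‖ ^ 2))

/-- The measure `dx / ((x² + 1)ⁿ |e(x)|²)` on `ℝ`. The norm of `B(e)` is that of
`L²(weight e 0)`. -/
def weight (e : ℂ → ℂ) (n : ℕ) : Measure ℝ :=
  volume.withDensity (weightDensity e n)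

/-- The space `assoc_n B = B + z B + ⋯ + zⁿ B` of `n`-associated functions. -/
def assoc (n : ℕ) (B : Submodule ℂ (ℂ → ℂ)) : Submodule ℂ (ℂ → ℂ) :=
  ⨆ k : Fin (n + 1), B.map (LinearMap.mulLeft ℂ (fun z : ℂ => z ^ (k : ℕ)))

theorem weightDensity_le (e : ℂ → ℂ) (n : ℕ) (x : ℝ) :
    weightDensity e n x ≤ weightDensity e 0 x := by
  unfold weightDensity
  apply ENNReal.ofReal_le_ofReal
  rw [pow_zero, one_mul]
  rcases eq_or_ne (‖e x‖ ^ 2) 0 with h0 | h0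
  · simp [h0]
  · have hpos : 0 < ‖e x‖ ^ 2 := lt_of_le_of_ne (by positivity) (Ne.symm h0)
    have h1 : (1 : ℝ) ≤ (x ^ 2 + 1) ^ n := one_le_pow₀ (by nlinarith [sq_nonneg x])
    exact one_div_le_one_div_of_le hpos (by nlinarith)

theorem weight_le (e : ℂ → ℂ) (n : ℕ) : weight e n ≤ weight e 0 :=
  withDensity_mono (Eventually.of_forall (weightDensity_le e n))

theorem measurable_weightDensity {e : ℂ → ℂ} (he : Differentiable ℂ e) (n : ℕ) :
    Measurable (weightDensity e n) := by
  have hc : Continuous fun x : ℝ => e x := he.continuous.comp Complex.continuous_ofReal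
  have hm : Measurable fun x : ℝ => ‖e x‖ := hc.norm.measurable
  unfold weightDensity
  fun_prop

theorem ae_weight_zero {e : ℂ → ℂ} (he : Differentiable ℂ e) (n : ℕ) {p : ℝ → Prop}
    (hp : ∀ᵐ x ∂weight e n, p x) : ∀ᵐ x ∂weight e 0, p x := by
  unfold weight at hp ⊢
  rw [ae_withDensity_iff (measurable_weightDensity he _)] at hp ⊢
  filter_upwards [hp] with x hx h0
  apply hx
  intro h1
  apply h0
  unfold weightDensity at h1 ⊢
  rw [ENNReal.ofReal_eq_zero] at h1 ⊢
  by_contra hcon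
  push Not at hcon
  apply absurd h1
  push Not
  have hpos : 0 < ‖e x‖ ^ 2 := by simpa using hcon
  positivity

/-! ### The functional model and the Gelfand triplet -/

section Triplet

variable {H : Type*} [NormedAddCommGroup H] [InnerProductSpace ℂ H]

/-- The functional model of `A`: a function `ξ`, together with a Hermite–Biehler function `e` such
that the de Branges space `Ĥ = Φ H` is `B(e)`, with equal norms. -/
structure FunctionalModel (A : H →ₗ.[ℂ] H) extends XiData A where
  e : ℂ → ℂ
  e_hermiteBiehler : IsHermiteBiehler e
  coe_Hhat : (toXiData.Hhat : Set (ℂ → ℂ)) = deBrangesSpace e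
  norm_Φ : ∀ φ : H, eLpNorm (fun x : ℝ => toXiData.Φ φ x) 2 (weight e 0) = ENNReal.ofReal ‖φ‖

namespace FunctionalModel

variable {A : H →ₗ.[ℂ] H} (M : FunctionalModel A) (n : ℕ)

theorem memLp_Φ (φ : H) : MemLp (fun x : ℝ => M.Φ φ x) 2 (weight M.e n) := by
  have h1 : M.Φ φ ∈ deBrangesSpace M.e := by
    rw [← M.coe_Hhat]; exact LinearMap.mem_range_self _ φ
  have hc : Continuous fun x : ℝ => M.Φ φ x := h1.1.continuous.comp Complex.continuous_ofReal
  have h0 : MemLp (fun x : ℝ => M.Φ φ x) 2 (weight M.e 0) :=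
    ⟨hc.aestronglyMeasurable, by rw [M.norm_Φ]; exact ENNReal.ofReal_lt_top⟩
  exact h0.mono_measure (weight_le M.e n)

/-- Elements of `H`, seen through `Φ` as functions on `ℝ`, in `L²(dx / ((x² + 1)ⁿ |e(x)|²))`. -/
def toL2 : H →L[ℂ] Lp ℂ 2 (weight M.e n) :=
  LinearMap.mkContinuous
    { toFun := fun φ => (M.memLp_Φ n φ).toLp _
      map_add' := fun a b => by
        rw [← MemLp.toLp_add]
        exact MemLp.toLp_congr _ _ (Eventually.of_forall fun x => by simp)
      map_smul' := fun c a => by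
        rw [RingHom.id_apply, ← MemLp.toLp_const_smul]
        exact MemLp.toLp_congr _ _ (Eventually.of_forall fun x => by simp) }
    1 (fun φ => by
      have h : eLpNorm (fun x : ℝ => M.Φ φ x) 2 (weight M.e n) ≤ ENNReal.ofReal ‖φ‖ := by
        rw [← M.norm_Φ φ]; exact eLpNorm_mono_measure _ (weight_le M.e n)
      rw [one_mul]
      simp only [LinearMap.coe_mk, AddHom.coe_mk, Lp.norm_toLp]
      exact ENNReal.toReal_le_of_le_ofReal (norm_nonneg φ) h)

theorem coeFn_toL2 (φ : H) : M.toL2 n φ =ᵐ[weight M.e n] fun x : ℝ => M.Φ φ x :=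
  MemLp.coeFn_toLp (M.memLp_Φ n φ)

theorem toL2_injective : Function.Injective (M.toL2 n) := by
  rw [injective_iff_map_eq_zero]
  intro φ hφ
  have h1 : ∀ᵐ x ∂weight M.e n, M.Φ φ (x : ℝ) = 0 := by
    have h2 := M.coeFn_toL2 n φ
    rw [hφ] at h2
    filter_upwards [h2, Lp.coeFn_zero ℂ 2 (weight M.e n)] with x hx hx0
    rw [← hx, hx0]; rfl
  have h3 := ae_weight_zero M.e_hermiteBiehler.1 n h1
  have h4 : eLpNorm (fun x : ℝ => M.Φ φ x) 2 (weight M.e 0) = 0 := by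
    rw [eLpNorm_congr_ae (g := fun _ => (0 : ℂ)) h3]; simp
  rw [M.norm_Φ, ENNReal.ofReal_eq_zero] at h4
  exact norm_le_zero_iff.mp h4

/-- `Ĥ_{-n}`: the functions of `assoc_n Ĥ`, with the inner product
`∫ conj (f x) g x / ((x² + 1)ⁿ |e(x)|²) dx`. An entire function is identified with its restriction
to `ℝ`, as an element of `L²`. -/
def HhatMinus : Submodule ℂ (Lp ℂ 2 (weight M.e n)) where
  carrier := {F | ∃ f ∈ assoc n M.Hhat, F =ᵐ[weight M.e n] fun x : ℝ => f x}
  zero_mem' := ⟨0, Submodule.zero_mem _, Lp.coeFn_zero ℂ 2 (weight M.e n)⟩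
  add_mem' := by
    rintro F G ⟨f, hf, hF⟩ ⟨g, hg, hG⟩
    refine ⟨f + g, Submodule.add_mem _ hf hg, ?_⟩
    filter_upwards [Lp.coeFn_add F G, hF, hG] with x h1 h2 h3
    rw [h1, Pi.add_apply, h2, h3]; rfl
  smul_mem' := by
    rintro c F ⟨f, hf, hF⟩
    refine ⟨c • f, Submodule.smul_mem _ c hf, ?_⟩
    filter_upwards [Lp.coeFn_smul c F, hF] with x h1 h2
    rw [h1, Pi.smul_apply, h2]; rfl

theorem toL2_mem (φ : H) : M.toL2 n φ ∈ M.HhatMinus n := by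
  refine ⟨M.Φ φ, ?_, M.coeFn_toL2 n φ⟩
  refine Submodule.mem_iSup_of_mem (0 : Fin (n + 1)) ⟨M.Φ φ, LinearMap.mem_range_self _ φ, ?_⟩
  ext z; simp

/-- The immersion of `Ĥ` (identified with `H` through `Φ`) into `Ĥ_{-n}`. -/
def immersion : H →L[ℂ] M.HhatMinus n :=
  (M.toL2 n).codRestrict (M.HhatMinus n) (M.toL2_mem n)

variable [CompleteSpace H]

/-- The map `D : Ĥ_{-n} → Ĥ`, the adjoint of the immersion; `Ĥ` is identified with `H`. -/
def D : M.HhatMinus n →L[ℂ] H :=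
  (ContinuousLinearMap.adjoint (M.toL2 n)).comp (M.HhatMinus n).subtypeL

theorem inner_D (g : H) (f : M.HhatMinus n) :
    inner ℂ g (M.D n f) = inner ℂ (M.immersion n g) f := by
  simp only [D, ContinuousLinearMap.comp_apply]
  rw [ContinuousLinearMap.adjoint_inner_right]; rfl

/-- The restriction of `D` to `Ĥ`. -/
def D₀ : H →L[ℂ] H := (M.D n).comp (M.immersion n)

theorem inner_D₀ (g f : H) :
    inner ℂ g (M.D₀ n f) = inner ℂ (M.toL2 n g) (M.toL2 n f) :=
  M.inner_D n g _

theorem D₀_inner (g f : H) :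
    inner ℂ (M.D₀ n g) f = inner ℂ (M.toL2 n g) (M.toL2 n f) := by
  rw [← inner_conj_symm, inner_D₀, inner_conj_symm]

theorem D₀_injective : Function.Injective (M.D₀ n) := by
  rw [injective_iff_map_eq_zero]
  intro φ hφ
  have h := M.inner_D₀ n φ φ
  rw [hφ, inner_zero_right] at h
  have h2 : M.toL2 n φ = 0 := inner_self_eq_zero.mp h.symm
  exact (injective_iff_map_eq_zero _).mp (M.toL2_injective n) φ h2

/-- `H_{+n}^{pre}`: the linear space `D Ĥ`, as a subspace of `H`, without the topology of `H`. -/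
def HplusPre : Type _ := LinearMap.range (M.D₀ n : H →ₗ[ℂ] H)

instance : AddCommGroup (M.HplusPre n) :=
  inferInstanceAs (AddCommGroup (LinearMap.range (M.D₀ n : H →ₗ[ℂ] H)))

instance : Module ℂ (M.HplusPre n) :=
  inferInstanceAs (Module ℂ (LinearMap.range (M.D₀ n : H →ₗ[ℂ] H)))

/-- The inclusion of `H_{+n}^{pre}` in `H`. -/
def preIncl : M.HplusPre n →ₗ[ℂ] H :=
  (LinearMap.range (M.D₀ n : H →ₗ[ℂ] H)).subtype

/-- `D⁻¹ : H_{+n}^{pre} → H`. -/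
def Dinv : M.HplusPre n ≃ₗ[ℂ] H :=
  (LinearEquiv.ofInjective (M.D₀ n : H →ₗ[ℂ] H) (M.D₀_injective n)).symm

theorem D₀_Dinv (g : M.HplusPre n) : M.D₀ n (M.Dinv n g) = M.preIncl n g :=
  congrArg Subtype.val
    ((LinearEquiv.ofInjective (M.D₀ n : H →ₗ[ℂ] H) (M.D₀_injective n)).apply_symm_apply g)

theorem preIncl_inner (g h : M.HplusPre n) :
    inner ℂ (M.preIncl n g) (M.Dinv n h) =
      inner ℂ (M.toL2 n (M.Dinv n g)) (M.toL2 n (M.Dinv n h)) := by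
  rw [← D₀_Dinv, D₀_inner]

/-- The inner product `⟪g, h⟫_{+n} = ⟪g, D⁻¹ h⟫`. -/
@[reducible]
def preCore : InnerProductSpace.Core ℂ (M.HplusPre n) where
  inner g h := inner ℂ (M.preIncl n g) (M.Dinv n h)
  conj_inner_symm g h := by
    simp only [preIncl_inner, inner_conj_symm]
  re_inner_nonneg g := by
    simp only [preIncl_inner]
    exact inner_self_nonneg
  add_left f g h := by simp only [map_add, inner_add_left]
  smul_left f g r := by simp only [map_smul, inner_smul_left]
  definite g hg := by
    simp only [preIncl_inner] at hg
    have h1 := (injective_iff_map_eq_zero _).mp (M.toL2_injective n) _ (inner_self_eq_zero.mp hg)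
    exact (LinearEquiv.map_eq_zero_iff _).mp h1

instance : NormedAddCommGroup (M.HplusPre n) := (M.preCore n).toNormedAddCommGroup

instance : InnerProductSpace ℂ (M.HplusPre n) :=
  InnerProductSpace.ofCore (M.preCore n).toCore

theorem norm_pre (g : M.HplusPre n) : ‖g‖ = ‖M.toL2 n (M.Dinv n g)‖ := by
  have h1 : (inner ℂ g g : ℂ) = inner ℂ (M.preIncl n g) (M.Dinv n g) := rfl
  have h2 : (‖g‖ : ℝ) ^ 2 = ‖M.toL2 n (M.Dinv n g)‖ ^ 2 := by
    rw [preIncl_inner, inner_self_eq_norm_sq_to_K, inner_self_eq_norm_sq_to_K] at h1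
    exact_mod_cast h1
  exact (pow_left_inj₀ (norm_nonneg _) (norm_nonneg _) two_ne_zero).mp h2

/-- The inclusion of `H_{+n}^{pre}` in `H` is continuous for the norm `‖·‖_{+n}`. -/
def preInclL : M.HplusPre n →L[ℂ] H :=
  (M.preIncl n).mkContinuous ‖ContinuousLinearMap.adjoint (M.toL2 n)‖ (fun g => by
    rw [norm_pre, ← D₀_Dinv]
    exact (ContinuousLinearMap.adjoint (M.toL2 n)).le_opNorm _)

/-- The Hilbert space `H_{+n}`, the completion of `H_{+n}^{pre}` for the norm `‖·‖_{+n}`. -/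
abbrev Hplus : Type _ := UniformSpace.Completion (M.HplusPre n)

/-- The continuous linear map `H_{+n} → H` that extends the inclusion of `H_{+n}^{pre}` in `H`. -/
def incl : M.Hplus n →L[ℂ] H :=
  (M.preInclL n).extend (UniformSpace.Completion.toComplL (𝕜 := ℂ) (E := M.HplusPre n))

/-- `H_{-n}`, the dual of `H_{+n}`: the continuous antilinear functionals on `H_{+n}`. -/
abbrev Hminus : Type _ := M.Hplus n →L⋆[ℂ] ℂ

/-- The duality bracket `[x, η]` between `H_{+n}` and `H_{-n}`; it is antilinear in `x` and
linear in `η`. -/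
def bracket (x : M.Hplus n) (η : M.Hminus n) : ℂ := η x

end FunctionalModel

/-! ### Krein's operators entire in the generalized sense -/

variable [CompleteSpace H]

open scoped LinearPMap in
/-- `H_-`: the antilinear functionals on `H_+ = dom (A*)` that are continuous for the graph norm. -/
def graphDual (A : H →ₗ.[ℂ] H) : Set (A†.domain →ₗ⋆[ℂ] ℂ) :=
  {μ | ∃ C : ℝ, ∀ x : A†.domain, ‖μ x‖ ≤ C * Real.sqrt (‖(x : H)‖ ^ 2 + ‖A† x‖ ^ 2)}

open scoped LinearPMap in
/-- The densely defined `A ∈ S(H)` is entire in the generalized sense: there is `μ ∈ H_-` with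
`[ξ(z̄), μ] ≠ 0` for all `z`, where `ξ(z̄)` lies in `H_+ = dom (A*)`. -/
def IsEntireGeneralized (A : H →ₗ.[ℂ] H) (ξ : ℂ → H) : Prop :=
  ∃ hξ : ∀ z : ℂ, ξ z ∈ A†.domain, ∃ μ ∈ graphDual A, ∀ z : ℂ, μ ⟨ξ (conj z), hξ (conj z)⟩ ≠ 0

end Triplet

end NEntire

end

noncomputable section
namespace NEntire

/-! ### Ranges and deficiency spaces of a regular symmetric operator. -/

section Operators

variable {H : Type*} [NormedAddCommGroup H] [InnerProductSpace ℂ H]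

/-! The map Φ turns `A` into multiplication by z. Since ξ(z̄) spans Ker(A* - z̄I), the range of A -
zI is exactly the kernel of f ↦ (Φf)(z). So m spans a complement of that range iff (Φm)(z) ≠ 0, and
`A` is n-entire iff some n-associated function Σ zʲ(Φμⱼ)(z) has no zeros (`isNEntire_iff`).

It remains to recognise these functions as the Hilbert space behind H_{+n}. Fix k with (Φk)(-i) = 1.
Repeated division by z + i writes each n-associated function uniquely as (z+i)ⁿ Φg + Σ_{j<n} cⱼ
(z+i)ʲ Φk. In the weighted L² space the first term is isometric in g and the rest is finite
dimensional. Hence these functions form a closed subspace, the data (g, c) depend boundedly on the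
function, and point evaluations are bounded. Density of dom A makes ΦH dense in this subspace
(`range_synthL2`).

H_{+n} maps isometrically onto the same subspace (`range_HplusToL2`), and `incl` becomes the adjoint
of the embedding of H. This gives injectivity and dense range. Bounded evaluation lifts ξ(z) to a
reproducing kernel in H_{+n}, and by Riesz every η in H_{-n} comes from an n-associated F with
[ξ(z), η] = F(z̄) (`inner_eq_synth`). A nonvanishing bracket is therefore a zero-free F.

For n = 1, `incl` maps H_{+1} onto dom A*, and its norm is equivalent to the graph norm. The two
notions of dual functional therefore agree. -/

theorem mem_ranSub {A : H →ₗ.[ℂ] H} {z : ℂ} {f : H} :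
    f ∈ ranSub A z ↔ ∃ a : A.domain, A a - z • (a : H) = f := Iff.rfl

theorem mem_kerAdjointSub {A : H →ₗ.[ℂ] H} {z : ℂ} {η : H} :
    η ∈ kerAdjointSub A z ↔ ∀ a : A.domain, inner ℂ η (A a) = conj z * inner ℂ η (a : H) := by
  constructor
  · intro h a
    have := h a (A a) (A.mem_graph a)
    simpa [inner_smul_left, mul_comm] using this
  · intro h φ χ hφ
    obtain ⟨a, ha, rfl⟩ := (A.mem_graph_iff).1 hφ
    have ha' : (a : H) = φ := ha
    subst ha'
    simpa [inner_smul_left, mul_comm] using h a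

theorem ranSub_orthogonal (A : H →ₗ.[ℂ] H) (z : ℂ) :
    (ranSub A z)ᗮ = kerAdjointSub A (conj z) := by
  ext η
  rw [Submodule.mem_orthogonal', mem_kerAdjointSub]
  constructor
  · intro h a
    have := h _ (mem_ranSub.2 ⟨a, rfl⟩)
    rw [inner_sub_right, inner_smul_right, sub_eq_zero] at this
    simpa using this
  · rintro h f ⟨a, rfl⟩
    change inner ℂ η (A a - z • (a : H)) = 0
    rw [inner_sub_right, inner_smul_right, h a]
    simp

/-- The map `(φ, χ) ↦ χ - zφ` on a linear relation. -/
def relSub (B : Submodule ℂ (H × H)) (z : ℂ) : B →L[ℂ] H :=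
  (ContinuousLinearMap.snd ℂ H H - z • ContinuousLinearMap.fst ℂ H H).comp B.subtypeL

@[simp]
theorem relSub_apply (B : Submodule ℂ (H × H)) (z : ℂ) (p : B) :
    relSub B z p = (p : H × H).2 - z • (p : H × H).1 := rfl

theorem range_relSub_graph (A : H →ₗ.[ℂ] H) (z : ℂ) :
    LinearMap.range (relSub A.graph z : A.graph →ₗ[ℂ] H) = ranSub A z := by
  ext f
  rw [mem_ranSub]
  constructor
  · rintro ⟨⟨p, hp⟩, rfl⟩
    obtain ⟨a, ha, hb⟩ := (A.mem_graph_iff).1 hp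
    exact ⟨a, by simp [ha, hb]⟩
  · rintro ⟨a, rfl⟩
    exact ⟨⟨_, A.mem_graph a⟩, by simp⟩

/-- The lower bound on A - zI controls φ, then Aφ, by Aφ - zφ. So (φ, χ) ↦ χ - zφ is bounded below
on the complete graph. -/
theorem isClosed_ranSub [CompleteSpace H] {A : H →ₗ.[ℂ] H} (hc : A.IsClosed) {z : ℂ} {d : ℝ}
    (hd : 0 < d) (hr : ∀ φ : A.domain, d * ‖(φ : H)‖ ≤ ‖A φ - z • (φ : H)‖) :
    IsClosed (ranSub A z : Set H) := by
  have hcomp : CompleteSpace A.graph := IsClosed.completeSpace_coe (hs := hc)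
  have hanti : AntilipschitzWith (Real.toNNReal (1 + ‖z‖ / d + 1 / d)) (relSub A.graph z) := by
    refine AddMonoidHomClass.antilipschitz_of_bound _ ?_
    rintro ⟨p, hp⟩
    obtain ⟨a, ha, hb⟩ := (A.mem_graph_iff).1 hp
    have hK : 0 ≤ 1 + ‖z‖ / d + 1 / d := by positivity
    rw [Real.coe_toNNReal _ hK]
    have h1 : ‖(a : H)‖ ≤ 1 / d * ‖A a - z • (a : H)‖ := by
      rw [one_div, ← div_eq_inv_mul, le_div_iff₀ hd, mul_comm]; exact hr a
    have h2 : ‖A a‖ ≤ ‖A a - z • (a : H)‖ + ‖z‖ * ‖(a : H)‖ := by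
      rw [← norm_smul]; exact norm_le_norm_sub_add _ _
    have h3 : ‖z‖ * ‖(a : H)‖ ≤ ‖z‖ / d * ‖A a - z • (a : H)‖ := by
      calc _ ≤ ‖z‖ * (1 / d * ‖A a - z • (a : H)‖) := by gcongr
        _ = _ := by ring
    have h4 : 0 ≤ ‖z‖ / d := by positivity
    have h5 : 0 ≤ 1 / d := by positivity
    simp only [relSub_apply, ← ha, ← hb, Submodule.coe_norm, Prod.norm_def]
    have h6 := norm_nonneg (A a - z • (a : H))
    refine max_le ?_ ?_ <;> nlinarith [mul_nonneg h4 h6, mul_nonneg h5 h6]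
  have := hanti.isClosed_range (relSub A.graph z).uniformContinuous
  rw [← range_relSub_graph]
  exact this

theorem ClassS.isClosed_ranSub [CompleteSpace H] {A : H →ₗ.[ℂ] H} (hA : ClassS A) (z : ℂ) :
    IsClosed (ranSub A z : Set H) := by
  obtain ⟨d, hd, hr⟩ := hA.regular z
  exact NEntire.isClosed_ranSub hA.closed hd hr

theorem ClassS.kerAdjointSub_orthogonal [CompleteSpace H] {A : H →ₗ.[ℂ] H} (hA : ClassS A)
    (z : ℂ) : (kerAdjointSub A z)ᗮ = ranSub A (conj z) := by
  have := ranSub_orthogonal A (conj z)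
  rw [Complex.conj_conj] at this
  rw [← this, Submodule.orthogonal_orthogonal_eq_closure]
  exact (hA.isClosed_ranSub (conj z)).submodule_topologicalClosure_eq

/-- If u = (A - w̄)a, then ‖u‖² = conj(z - w)⟪u, a⟫, while d‖a‖ ≤ ‖u‖. For |z - w| < d this forces u
= 0. It is the local stability of the deficiency index. -/
theorem eq_zero_of_mem_kerAdjointSub_of_mem_ranSub {A : H →ₗ.[ℂ] H} {z w : ℂ} {d : ℝ}
    (hr : ∀ φ : A.domain, d * ‖(φ : H)‖ ≤ ‖A φ - conj w • (φ : H)‖)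
    (hzw : ‖z - w‖ < d) {u : H} (hu : u ∈ kerAdjointSub A z) (hu' : u ∈ ranSub A (conj w)) :
    u = 0 := by
  obtain ⟨a, ha⟩ := mem_ranSub.1 hu'
  have h1 := mem_kerAdjointSub.1 hu a
  have h2 : inner ℂ u u = conj (z - w) * inner ℂ u (a : H) := by
    nth_rewrite 2 [← ha]
    rw [inner_sub_right, inner_smul_right, h1, map_sub]; ring
  have h3 : ‖u‖ * ‖u‖ ≤ ‖z - w‖ * (‖u‖ * ‖(a : H)‖) := by
    have : ‖(inner ℂ u u : ℂ)‖ = ‖u‖ * ‖u‖ := by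
      rw [inner_self_eq_norm_sq_to_K]; simp [sq]
    rw [← this, h2, norm_mul, RCLike.norm_conj]
    gcongr
    exact norm_inner_le_norm _ _
  have h4 : d * ‖(a : H)‖ ≤ ‖u‖ := ha ▸ hr a
  by_contra hne
  have hpos : 0 < ‖u‖ := norm_pos_iff.2 hne
  have h5 : ‖u‖ ≤ ‖z - w‖ * ‖(a : H)‖ := by
    refine le_of_mul_le_mul_left ?_ hpos
    linarith
  have ha0 : 0 < ‖(a : H)‖ := by
    by_contra h
    have : ‖(a : H)‖ = 0 := le_antisymm (not_lt.1 h) (norm_nonneg _)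
    rw [this] at h5; linarith
  nlinarith

/-- Pairing with a generator u₀ at w is injective on the kernel at z: a vector orthogonal to u₀ lies
in ran(A - w̄), where the gap estimate kills it. -/
theorem ClassS.kerAdjointSub_le_span_of_near [CompleteSpace H] {A : H →ₗ.[ℂ] H} (hA : ClassS A)
    {z w : ℂ} {d : ℝ}
    (hr : ∀ φ : A.domain, d * ‖(φ : H)‖ ≤ ‖A φ - conj w • (φ : H)‖) (hzw : ‖z - w‖ < d)
    (hw : ∃ u, kerAdjointSub A w ≤ ℂ ∙ u) : ∃ u, kerAdjointSub A z ≤ ℂ ∙ u := by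
  obtain ⟨u₀, hu₀⟩ := hw
  have key : ∀ u ∈ kerAdjointSub A z, inner ℂ u₀ u = 0 → u = 0 := by
    intro u hu h0
    refine eq_zero_of_mem_kerAdjointSub_of_mem_ranSub hr hzw hu ?_
    rw [← hA.kerAdjointSub_orthogonal]
    exact Submodule.orthogonal_le hu₀ (Submodule.mem_orthogonal_singleton_iff_inner_right.2 h0)
  by_cases hne : ∃ a ∈ kerAdjointSub A z, a ≠ 0
  · obtain ⟨a, ha, ha0⟩ := hne
    have hc : inner ℂ u₀ a ≠ 0 := fun h => ha0 (key a ha h)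
    refine ⟨a, fun b hb => Submodule.mem_span_singleton.2 ⟨inner ℂ u₀ b / inner ℂ u₀ a, ?_⟩⟩
    refine (sub_eq_zero.1 (key _ (Submodule.sub_mem _ hb (Submodule.smul_mem _ _ ha)) ?_)).symm
    rw [inner_sub_right, inner_smul_right, div_mul_cancel₀ _ hc, sub_self]
  · push Not at hne
    exact ⟨0, fun b hb => by rw [hne b hb]; exact Submodule.zero_mem _⟩

/-- For `A ∈ S(H)`, all the spaces `Ker (A* - zI)` have dimension at most one. -/
theorem ClassS.kerAdjointSub_le_span [CompleteSpace H] {A : H →ₗ.[ℂ] H} (hA : ClassS A) (z : ℂ) :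
    ∃ u, kerAdjointSub A z ≤ ℂ ∙ u := by
  -- Regularity at every point, real points included, makes this set clopen. It contains i, and ℂ is
  -- connected.
  let S : Set ℂ := {z | ∃ u, kerAdjointSub A z ≤ ℂ ∙ u}
  have hopen : IsOpen S := by
    rw [Metric.isOpen_iff]
    intro w hw
    obtain ⟨d, hd, hr⟩ := hA.regular (conj w)
    refine ⟨d, hd, fun z hz => hA.kerAdjointSub_le_span_of_near hr ?_ hw⟩
    simpa [dist_eq_norm] using hz
  have hopen' : IsOpen Sᶜ := by
    rw [Metric.isOpen_iff]
    intro z hz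
    obtain ⟨d, hd, hr⟩ := hA.regular (conj z)
    -- The lower bound is known at z but needed at w. Moving it costs |z - w|‖φ‖, hence half of d.
    refine ⟨d / 2, by positivity, fun w hw hwS => hz ?_⟩
    have hzw : ‖z - w‖ < d / 2 := by
      rw [norm_sub_rev]; simpa [dist_eq_norm] using hw
    refine hA.kerAdjointSub_le_span_of_near (w := w) (d := d / 2) ?_ hzw hwS
    intro φ
    have h1 := hr φ
    have h2 : ‖A φ - conj z • (φ : H)‖ ≤ ‖A φ - conj w • (φ : H)‖ + ‖z - w‖ * ‖(φ : H)‖ := by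
      have h : A φ - conj z • (φ : H) = (A φ - conj w • (φ : H)) - conj (z - w) • (φ : H) := by
        rw [map_sub, sub_smul]; abel
      rw [h]
      refine (norm_sub_le _ _).trans_eq ?_
      rw [norm_smul, RCLike.norm_conj]
    nlinarith [norm_nonneg (φ : H)]
  have hS : IsClopen S := ⟨⟨hopen'⟩, hopen⟩
  have hI : Complex.I ∈ S := by
    obtain ⟨u, -, hu⟩ := finrank_eq_one_iff'.1 hA.deficiency_pos
    refine ⟨u, fun b hb => ?_⟩
    obtain ⟨c, hc⟩ := hu ⟨b, hb⟩
    exact Submodule.mem_span_singleton.2 ⟨c, congrArg Subtype.val hc⟩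
  have := hS.eq_univ ⟨_, hI⟩
  exact (this ▸ Set.mem_univ z : z ∈ S)

theorem ClassS.mem_ranSub_iff_inner_eq_zero [CompleteSpace H] {A : H →ₗ.[ℂ] H}
    (hA : ClassS A) {z : ℂ} {u : H} (hu : u ∈ kerAdjointSub A z) (hu0 : u ≠ 0) {f : H} :
    f ∈ ranSub A (conj z) ↔ inner ℂ u f = 0 := by
  obtain ⟨u₀, hu₀⟩ := hA.kerAdjointSub_le_span z
  rw [← hA.kerAdjointSub_orthogonal, Submodule.mem_orthogonal]
  refine ⟨fun h => h u hu, fun h w hw => ?_⟩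
  obtain ⟨a, rfl⟩ := Submodule.mem_span_singleton.1 (hu₀ hu)
  obtain ⟨b, rfl⟩ := Submodule.mem_span_singleton.1 (hu₀ hw)
  have ha : a ≠ 0 := by rintro rfl; simp at hu0
  rw [inner_smul_left] at h ⊢
  rcases mul_eq_zero.1 h with h | h
  · exact absurd ((map_eq_zero _).1 h) ha
  · rw [h, mul_zero]

/-! ### Canonical selfadjoint extensions -/

theorem isClosed_adjointRel (B : Submodule ℂ (H × H)) :
    IsClosed (adjointRel B : Set (H × H)) := by
  have : (adjointRel B : Set (H × H)) =
      ⋂ p : B, {q : H × H | inner ℂ q.1 (p : H × H).2 = inner ℂ q.2 (p : H × H).1} := by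
    ext q
    simp only [Set.mem_iInter, Set.mem_ofPred_eq, SetLike.mem_coe]
    exact ⟨fun h p => h _ _ p.2, fun h φ χ hp => h ⟨(φ, χ), hp⟩⟩
  rw [this]
  exact isClosed_iInter fun p => isClosed_eq (by fun_prop) (by fun_prop)

section Extension

variable {A : H →ₗ.[ℂ] H} {B : Submodule ℂ (H × H)}

theorem IsCanonicalSAExt.inner_eq (hB : IsCanonicalSAExt A B) {p q : H × H} (hp : p ∈ B)
    (hq : q ∈ B) : inner ℂ p.1 q.2 = inner ℂ p.2 q.1 := by
  rw [← hB.2] at hp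
  exact hp q.1 q.2 hq

theorem IsCanonicalSAExt.conj_eigenvalue (hB : IsCanonicalSAExt A B) {z : ℂ} {u : H}
    (hu : u ≠ 0) (h : (u, z • u) ∈ B) : conj z = z := by
  have := hB.inner_eq h h
  simp only [inner_smul_left, inner_smul_right] at this
  exact (mul_right_cancel₀ (inner_self_ne_zero.2 hu) this).symm

theorem IsCanonicalSAExt.mem_of_orthogonal (hB : IsCanonicalSAExt A B) {z : ℂ} {η : H}
    (h : ∀ p : B, inner ℂ η (relSub B z p) = 0) : (η, conj z • η) ∈ B := by
  rw [← hB.2]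
  intro φ χ hp
  have := h ⟨(φ, χ), hp⟩
  simp only [relSub_apply, inner_sub_right, inner_smul_right, sub_eq_zero] at this
  simp [this, mul_comm]

/-- Every point of the spectrum of a canonical selfadjoint extension is a real eigenvalue. -/
theorem IsCanonicalSAExt.exists_eigenvector [CompleteSpace H] (hA : ClassS A)
    (hB : IsCanonicalSAExt A B) {z : ℂ} (hz : z ∈ relSpectrum B) :
    conj z = z ∧ ∃ u : H, u ≠ 0 ∧ (u, z • u) ∈ B := by
  by_contra hcon
  have hno : ∀ u : H, (u, z • u) ∈ B → u = 0 := by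
    intro u hu
    by_contra h0
    exact hcon ⟨hB.conj_eigenvalue h0 hu, u, h0, hu⟩
  have hno' : ∀ u : H, (u, conj z • u) ∈ B → u = 0 := by
    intro u hu
    by_contra h0
    have h1 := hB.conj_eigenvalue h0 hu
    rw [Complex.conj_conj] at h1
    exact h0 (hno u (h1 ▸ hu))
  have hBc : IsClosed (B : Set (H × H)) := by rw [← hB.2]; exact isClosed_adjointRel B
  have hcomp : CompleteSpace B := hBc.completeSpace_coe
  have hinj : LinearMap.ker (relSub B z : B →ₗ[ℂ] H) = ⊥ := by
    rw [LinearMap.ker_eq_bot']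
    rintro ⟨⟨a, b⟩, hp⟩ h0
    have h1 : b = z • a := sub_eq_zero.1 h0
    subst h1
    have := hno a hp
    subst this
    simp
  have hsub : ∀ f ∈ ranSub A z, f ∈ LinearMap.range (relSub B z : B →ₗ[ℂ] H) := by
    intro f hf
    rw [← range_relSub_graph] at hf
    obtain ⟨p, rfl⟩ := hf
    exact ⟨⟨p, hB.1 p.2⟩, rfl⟩
  -- Already ran(A - z) contains the hyperplane orthogonal to u₀. Either some vector of ran(B - z)
  -- lies off this hyperplane, or u₀ is orthogonal to ran(B - z). In the latter case (u₀, z̄u₀) ∈ B,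
  -- so u₀ = 0 and the hyperplane is all of H.
  have hsurj : LinearMap.range (relSub B z : B →ₗ[ℂ] H) = ⊤ := by
    obtain ⟨u₀, hu₀⟩ := hA.kerAdjointSub_le_span (conj z)
    have h1 : ∀ f, inner ℂ u₀ f = 0 → f ∈ LinearMap.range (relSub B z : B →ₗ[ℂ] H) := by
      intro f hf
      apply hsub
      have h2 := hA.kerAdjointSub_orthogonal (conj z)
      rw [Complex.conj_conj] at h2
      rw [← h2]
      exact Submodule.orthogonal_le hu₀ (Submodule.mem_orthogonal_singleton_iff_inner_right.2 hf)
    rw [eq_top_iff]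
    intro f _
    by_cases h : ∀ p : B, inner ℂ u₀ (relSub B z p) = 0
    · have := hno' u₀ (hB.mem_of_orthogonal h)
      exact h1 f (by simp [this])
    · push Not at h
      obtain ⟨p, hp⟩ := h
      have h2 : f - (inner ℂ u₀ f / inner ℂ u₀ (relSub B z p)) • relSub B z p ∈
          LinearMap.range (relSub B z : B →ₗ[ℂ] H) := by
        apply h1
        rw [inner_sub_right, inner_smul_right, div_mul_cancel₀ _ hp, sub_self]
      have h3 := Submodule.add_mem _ h2 (Submodule.smul_mem _
        (inner ℂ u₀ f / inner ℂ u₀ (relSub B z p)) (LinearMap.mem_range_self _ p))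
      simpa using h3
  let E := ContinuousLinearEquiv.ofBijective (relSub B z) hinj hsurj
  refine hz ⟨(ContinuousLinearMap.fst ℂ H H).comp (B.subtypeL.comp E.symm.toContinuousLinearMap),
    fun f g => ?_⟩
  have hE : ((E.symm f : B) : H × H).2 - z • ((E.symm f : B) : H × H).1 = f :=
    E.apply_symm_apply f
  constructor
  · rintro rfl
    have : ((E.symm f : B) : H × H) ∈ B := (E.symm f).2
    convert this using 1
    ext
    · rfl
    · exact (sub_eq_iff_eq_add.1 hE).symm
  · intro h
    have : E.symm f = ⟨_, h⟩ := by
      rw [ContinuousLinearEquiv.symm_apply_eq]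
      change f = relSub B z ⟨_, h⟩
      simp
    change ((E.symm f : B) : H × H).1 = g
    rw [this]

theorem isResolvent_relResolvent {z : ℂ} (hz : z ∉ relSpectrum B) :
    IsResolvent B z (relResolvent B z) := by
  have h : ∃ R : H →L[ℂ] H, IsResolvent B z R := not_not.1 hz
  rw [relResolvent, dif_pos h]
  exact h.choose_spec

theorem relResolvent_mem {z : ℂ} (hz : z ∉ relSpectrum B) (f : H) :
    (relResolvent B z f, f + z • relResolvent B z f) ∈ B :=
  (isResolvent_relResolvent hz f _).1 rfl

theorem eq_zero_of_mem_of_notMem_relSpectrum {z : ℂ} (hz : z ∉ relSpectrum B) {u : H}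
    (hu : (u, z • u) ∈ B) : u = 0 := by
  rw [← (isResolvent_relResolvent hz 0 u).2 (by simpa using hu), map_zero]

/-- First resolvent identity, read off from membership in the relation. -/
theorem relResolvent_eq {z w : ℂ} (hz : z ∉ relSpectrum B) (hw : w ∉ relSpectrum B) (f : H) :
    relResolvent B w f = relResolvent B z f + (w - z) • relResolvent B z (relResolvent B w f) := by
  rw [← map_smul, ← map_add]
  refine ((isResolvent_relResolvent hz _ _).2 ?_).symm
  convert relResolvent_mem hw f using 2
  rw [sub_smul]; abel

theorem tendsto_relResolvent {z : ℂ} (hz : ∀ᶠ w in 𝓝 z, w ∉ relSpectrum B) (f : H) :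
    Tendsto (fun w => relResolvent B w f) (𝓝 z) (𝓝 (relResolvent B z f)) := by
  have hz0 := hz.self_of_nhds
  set R := relResolvent B z
  -- The threshold 1/2 lets the last term of the resolvent identity be absorbed, giving the uniform
  -- bound ‖g‖ ≤ 2‖R‖‖f‖ below.
  have h1 : ∀ᶠ w in 𝓝 z, ‖w - z‖ * ‖R‖ < 1 / 2 := by
    have : Tendsto (fun w : ℂ => ‖w - z‖ * ‖R‖) (𝓝 z) (𝓝 (‖z - z‖ * ‖R‖)) :=
      Continuous.tendsto (by fun_prop) z
    rw [sub_self, norm_zero, zero_mul] at this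
    exact this.eventually (gt_mem_nhds (by norm_num))
  rw [tendsto_iff_norm_sub_tendsto_zero]
  have h2 : Tendsto (fun w : ℂ => ‖w - z‖ * (‖R‖ * (2 * (‖R‖ * ‖f‖)))) (𝓝 z) (𝓝 0) := by
    have : Tendsto (fun w : ℂ => ‖w - z‖ * (‖R‖ * (2 * (‖R‖ * ‖f‖)))) (𝓝 z)
        (𝓝 (‖z - z‖ * (‖R‖ * (2 * (‖R‖ * ‖f‖))))) := Continuous.tendsto (by fun_prop) z
    simpa using this
  refine squeeze_zero' (Eventually.of_forall fun _ => norm_nonneg _) ?_ h2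
  filter_upwards [hz, h1] with w hw hw1
  set g := relResolvent B w f
  have h3 : g = R f + (w - z) • R g := relResolvent_eq hz0 hw f
  have h4 : ‖R g‖ ≤ ‖R‖ * ‖g‖ := R.le_opNorm g
  have h5 : ‖g‖ ≤ ‖R‖ * ‖f‖ + ‖w - z‖ * (‖R‖ * ‖g‖) := by
    calc ‖g‖ = ‖R f + (w - z) • R g‖ := by rw [← h3]
      _ ≤ ‖R f‖ + ‖w - z‖ * ‖R g‖ := by rw [← norm_smul]; exact norm_add_le _ _
      _ ≤ _ := by gcongr; exact R.le_opNorm f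
  have h6 : ‖g‖ ≤ 2 * (‖R‖ * ‖f‖) := by nlinarith [norm_nonneg g]
  have h7 : g - R f = (w - z) • R g := by rw [sub_eq_iff_eq_add']; exact h3
  rw [h7, norm_smul]
  gcongr
  exact h4.trans (by gcongr)

end Extension

/-! ### The function `ξ` -/

namespace XiData

variable {A : H →ₗ.[ℂ] H} (X : XiData A)

theorem Φ_apply (φ : H) (z : ℂ) : X.Φ φ z = inner ℂ (X.ξ (conj z)) φ := rfl

theorem eventually_notMem_of_notMem {z : ℂ} (hz : z ∉ relSpectrum X.ext) :
    ∀ᶠ w in 𝓝 z, w ∉ relSpectrum X.ext := by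
  have h0 : X.h z ≠ 0 := fun h => hz ((X.h_zeros z).1 h)
  filter_upwards [X.h_entire.continuous.continuousAt.eventually_ne h0] with w hw h
  exact hw ((X.h_zeros w).2 h)

/-- The spectrum is the zero set of `h`, and a simple zero is isolated. -/
theorem eventually_notMem (z : ℂ) : ∀ᶠ w in 𝓝[≠] z, w ∉ relSpectrum X.ext := by
  by_cases hz : X.h z = 0
  · have := (X.h_entire z).hasDerivAt.eventually_ne (c := 0) (X.h_simple z hz)
    filter_upwards [this] with w hw h
    exact hw ((X.h_zeros w).2 h)
  · exact (X.eventually_notMem_of_notMem fun h => hz ((X.h_zeros z).2 h)).filter_mono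
      nhdsWithin_le_nhds

theorem ξ_eq {z : ℂ} (hz : z ∉ relSpectrum X.ext) :
    X.ξ z = X.h z • (X.ψ + (z - (X.v : ℂ)) • relResolvent X.ext z X.ψ) := by
  refine Tendsto.limUnder_eq (Tendsto.mono_left ?_ nhdsWithin_le_nhds)
  have h1 : Tendsto X.h (𝓝 z) (𝓝 (X.h z)) := X.h_entire.continuous.tendsto z
  have h2 := tendsto_relResolvent (X.eventually_notMem_of_notMem hz) X.ψ
  have h3 : Tendsto (fun w : ℂ => w - (X.v : ℂ)) (𝓝 z) (𝓝 (z - X.v)) :=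
    Continuous.tendsto (by fun_prop) z
  exact h1.smul (tendsto_const_nhds.add (h3.smul h2))

theorem ξ_mem_of_notMem {z : ℂ} (hz : z ∉ relSpectrum X.ext) : X.ξ z ∈ kerAdjointSub A z := by
  rw [X.ξ_eq hz]
  refine Submodule.smul_mem _ _ (mem_kerAdjointSub.2 fun a => ?_)
  have h1 := mem_kerAdjointSub.1 X.ψ_mem a
  have h2 := X.ext_canonical.inner_eq (relResolvent_mem hz X.ψ)
    (X.ext_canonical.1 (A.mem_graph a))
  simp only [inner_add_left, inner_smul_left, Complex.conj_ofReal, map_sub] at h1 h2 ⊢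
  rw [h1, h2]
  ring

/-- If ψ + (z - v)Rψ = 0 with R the resolvent at z, then (Rψ, vRψ) lies in the extension. As v is
outside its spectrum, Rψ = 0 and ψ = 0. -/
theorem ξ_ne_zero_of_notMem {z : ℂ} (hz : z ∉ relSpectrum X.ext) : X.ξ z ≠ 0 := by
  rw [X.ξ_eq hz]
  intro h
  have hh : X.h z ≠ 0 := fun h => hz ((X.h_zeros z).1 h)
  have h1 := (smul_eq_zero.1 h).resolve_left hh
  have h2 : X.ψ = ((X.v : ℂ) - z) • relResolvent X.ext z X.ψ := by
    rw [eq_neg_of_add_eq_zero_left h1, ← neg_smul, neg_sub]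
    exact congrArg _ (congrArg _ (by rw [← neg_sub, neg_smul, ← eq_neg_of_add_eq_zero_left h1]))
  have h3 := relResolvent_mem hz X.ψ
  have h4 : X.ψ + z • relResolvent X.ext z X.ψ = (X.v : ℂ) • relResolvent X.ext z X.ψ := by
    nth_rewrite 1 [h2]
    rw [← add_smul]; congr 1; ring
  rw [h4] at h3
  have h5 := eq_zero_of_mem_of_notMem_relSpectrum X.v_notMem h3
  rw [h5, smul_zero] at h2
  exact X.ψ_ne_zero h2

/-- The functions of the functional model are continuous. -/
def WeaklyContinuous : Prop := ∀ φ : H, Continuous (X.Φ φ)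

variable {X}

theorem WeaklyContinuous.inner_ξ (hX : X.WeaklyContinuous) (φ : H) :
    Continuous fun z => inner ℂ (X.ξ z) φ := by
  simpa [Function.comp_def, Φ_apply] using (hX φ).comp Complex.continuous_conj

/-- The defining identity passes to the limit at a spectral point. Norm convergence of the limit
defining ξ is not needed: weak continuity already ties ξ(z) to the nearby values. -/
theorem WeaklyContinuous.ξ_mem (hX : X.WeaklyContinuous) (z : ℂ) :
    X.ξ z ∈ kerAdjointSub A z := by
  refine mem_kerAdjointSub.2 fun a => ?_
  have h1 : Tendsto (fun w => inner ℂ (X.ξ w) (A a)) (𝓝[≠] z) (𝓝 (inner ℂ (X.ξ z) (A a))) :=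
    ((hX.inner_ξ (A a)).tendsto z).mono_left nhdsWithin_le_nhds
  have h2 : Tendsto (fun w => conj w * inner ℂ (X.ξ w) (a : H)) (𝓝[≠] z)
      (𝓝 (conj z * inner ℂ (X.ξ z) (a : H))) :=
    ((Complex.continuous_conj.mul (hX.inner_ξ (a : H))).tendsto z).mono_left nhdsWithin_le_nhds
  refine tendsto_nhds_unique_of_eventuallyEq h1 h2 ?_
  filter_upwards [X.eventually_notMem z] with w hw
  exact mem_kerAdjointSub.1 (X.ξ_mem_of_notMem hw) a

/-- At a spectral point z with eigenvector u, (z - w)⟪u, ξ(w)⟫ = h(w)(z - v)⟪u, ψ⟫. Dividing by z -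
w and letting w → z, ξ(z) = 0 would give h'(z)(z - v)⟪u, ψ⟫ = 0, so ⟪u, ψ⟫ = 0 because the zero of h
is simple. Then u = (A - v)a, and injectivity of the extension at v gives u = (z - v)a. Hence Aa =
za, against regularity. -/
theorem WeaklyContinuous.ξ_ne_zero [CompleteSpace H] (hX : X.WeaklyContinuous) (hA : ClassS A)
    (z : ℂ) : X.ξ z ≠ 0 := by
  by_cases hz : z ∈ relSpectrum X.ext
  swap
  · exact X.ξ_ne_zero_of_notMem hz
  intro h0
  obtain ⟨hreal, u, hu0, hu⟩ := X.ext_canonical.exists_eigenvector hA hz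
  have hzv : z ≠ X.v := fun h => X.v_notMem (h ▸ hz)
  have key : ∀ w, w ∉ relSpectrum X.ext →
      (z - w) * inner ℂ u (X.ξ w) = X.h w * ((z - X.v) * inner ℂ u X.ψ) := by
    intro w hw
    have h1 := X.ext_canonical.inner_eq hu (relResolvent_mem hw X.ψ)
    simp only [inner_add_right, inner_smul_left, inner_smul_right, hreal] at h1
    rw [X.ξ_eq hw, inner_smul_right, inner_add_right, inner_smul_right]
    linear_combination X.h w * (w - X.v) * (-h1)
  have hψ : inner ℂ u X.ψ = 0 := by
    have hq : Tendsto (fun w => inner ℂ u (X.ξ w)) (𝓝[≠] z) (𝓝 0) := by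
      have h1 : Continuous fun w => inner ℂ u (X.ξ w) := by
        simpa [Function.comp_def] using Complex.continuous_conj.comp (hX.inner_ξ u)
      have := (h1.tendsto z).mono_left (nhdsWithin_le_nhds (s := {z}ᶜ))
      simpa [h0] using this
    have hs : Tendsto (fun w => slope X.h z w * ((z - X.v) * inner ℂ u X.ψ)) (𝓝[≠] z)
        (𝓝 (deriv X.h z * ((z - X.v) * inner ℂ u X.ψ))) :=
      (hasDerivAt_iff_tendsto_slope.1 (X.h_entire z).hasDerivAt).mul_const _
    have heq : (fun w => -inner ℂ u (X.ξ w)) =ᶠ[𝓝[≠] z]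
        fun w => slope X.h z w * ((z - X.v) * inner ℂ u X.ψ) := by
      filter_upwards [X.eventually_notMem z, self_mem_nhdsWithin] with w hw hwz
      have hwz' : w - z ≠ 0 := sub_ne_zero.2 hwz
      rw [slope_def_field, (X.h_zeros z).2 hz, sub_zero]
      field_simp
      linear_combination key w hw
    have := tendsto_nhds_unique_of_eventuallyEq hq.neg hs heq
    rw [neg_zero] at this
    have h3 := (mul_eq_zero.1 this.symm).resolve_left (X.h_simple z ((X.h_zeros z).2 hz))
    exact (mul_eq_zero.1 h3).resolve_left (sub_ne_zero.2 hzv)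
  have hran : u ∈ ranSub A (X.v : ℂ) := by
    have := (hA.mem_ranSub_iff_inner_eq_zero (f := u) X.ψ_mem X.ψ_ne_zero).2
      (by rw [← inner_conj_symm, hψ, map_zero])
    simpa using this
  obtain ⟨a, ha⟩ := mem_ranSub.1 hran
  have h1 : ((a : H), u + (X.v : ℂ) • (a : H)) ∈ X.ext := by
    have := X.ext_canonical.1 (A.mem_graph a)
    rwa [← ha, sub_add_cancel]
  have h2 : u = (z - X.v) • (a : H) := by
    have h3 := X.ext.sub_mem hu (X.ext.smul_mem (z - X.v) h1)
    have h4 : (u, z • u) - (z - (X.v : ℂ)) • ((a : H), u + (X.v : ℂ) • (a : H)) =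
        (u - (z - (X.v : ℂ)) • (a : H), (X.v : ℂ) • (u - (z - (X.v : ℂ)) • (a : H))) := by
      ext
      · rfl
      · simp only [Prod.snd_sub, Prod.smul_snd]
        module
    rw [h4] at h3
    exact sub_eq_zero.1 (eq_zero_of_mem_of_notMem_relSpectrum X.v_notMem h3)
  have h5 : A a - z • (a : H) = 0 := by
    have : A a = u + (X.v : ℂ) • (a : H) := by rw [← ha]; abel
    rw [this]
    nth_rewrite 1 [h2]
    module
  obtain ⟨d, hd, hr⟩ := hA.regular z
  have h6 := hr a
  rw [h5, norm_zero] at h6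
  have h7 : (a : H) = 0 := by
    rw [← norm_le_zero_iff]
    by_contra h
    push Not at h
    nlinarith
  exact hu0 (by rw [h2, h7, smul_zero])

/-- The one-dimensional space Ker(A* - z̄I) is spanned by ξ(z̄), and its orthogonal complement is
the closed range. -/
theorem WeaklyContinuous.mem_ranSub_iff [CompleteSpace H] (hX : X.WeaklyContinuous)
    (hA : ClassS A) (z : ℂ) (f : H) : f ∈ ranSub A z ↔ X.Φ f z = 0 := by
  have := hA.mem_ranSub_iff_inner_eq_zero (f := f) (hX.ξ_mem (conj z)) (hX.ξ_ne_zero hA (conj z))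
  rwa [Complex.conj_conj] at this

theorem WeaklyContinuous.Φ_apply_operator (hX : X.WeaklyContinuous) (a : A.domain) (z : ℂ) :
    X.Φ (A a) z = z * X.Φ a z := by
  have := mem_kerAdjointSub.1 (hX.ξ_mem (conj z)) a
  rwa [Complex.conj_conj] at this

end XiData

end Operators

/-! ### Weighted `L²` norms -/

theorem eLpNorm_weight_le {e : ℂ → ℂ} (he : Differentiable ℂ e) {m n : ℕ} {f g : ℝ → ℂ}
    (h : ∀ x : ℝ, ‖f x‖ ^ 2 * (x ^ 2 + 1) ^ n ≤ ‖g x‖ ^ 2 * (x ^ 2 + 1) ^ m) :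
    eLpNorm f 2 (weight e m) ≤ eLpNorm g 2 (weight e n) := by
  have hfin : ∀ k, ∀ᵐ x : ℝ, weightDensity e k x < ∞ := fun k =>
    Eventually.of_forall fun x => ENNReal.ofReal_lt_top
  simp only [eLpNorm_eq_lintegral_rpow_enorm_toReal two_ne_zero ENNReal.ofNat_ne_top,
    ENNReal.toReal_ofNat, weight]
  refine ENNReal.rpow_le_rpow ?_ (by norm_num)
  rw [lintegral_withDensity_eq_lintegral_mul_non_measurable _ (measurable_weightDensity he m)
    (hfin m), lintegral_withDensity_eq_lintegral_mul_non_measurable _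
    (measurable_weightDensity he n) (hfin n)]
  refine lintegral_mono fun x => ?_
  simp only [Pi.mul_apply, weightDensity, ENNReal.rpow_ofNat, ← ofReal_norm]
  rw [← ENNReal.ofReal_pow (norm_nonneg _), ← ENNReal.ofReal_pow (norm_nonneg _),
    ← ENNReal.ofReal_mul (by positivity), ← ENNReal.ofReal_mul (by positivity)]
  refine ENNReal.ofReal_le_ofReal ?_
  rcases eq_or_ne (‖e x‖ ^ 2) 0 with h0 | h0
  -- At a real zero of e the density is 1/0 = 0, so both integrands vanish.
  · simp [h0]
  · have hpos : 0 < ‖e x‖ ^ 2 := lt_of_le_of_ne (by positivity) (Ne.symm h0)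
    rw [one_div_mul_eq_div, one_div_mul_eq_div, div_le_div_iff₀ (by positivity) (by positivity)]
    calc _ = (‖f x‖ ^ 2 * (x ^ 2 + 1) ^ n) * ‖e x‖ ^ 2 := by ring
      _ ≤ (‖g x‖ ^ 2 * (x ^ 2 + 1) ^ m) * ‖e x‖ ^ 2 :=
        mul_le_mul_of_nonneg_right (h x) (by positivity)
      _ = _ := by ring

theorem norm_ofReal_add_I_sq (x : ℝ) : ‖(x : ℂ) + Complex.I‖ ^ 2 = x ^ 2 + 1 := by
  rw [← Complex.normSq_eq_norm_sq, Complex.normSq_apply]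
  simp [sq]

/-- An entire function is determined by its restriction to `ℝ`. -/
theorem eq_zero_of_forall_ofReal {F : ℂ → ℂ} (hF : Differentiable ℂ F)
    (h : ∀ x : ℝ, F x = 0) : F = 0 := by
  have hfreq : ∃ᶠ z in 𝓝[≠] (0 : ℂ), F z = 0 := by
    have ht : Tendsto (fun x : ℝ => (x : ℂ)) (𝓝[≠] 0) (𝓝[≠] 0) := by
      refine tendsto_nhdsWithin_iff.2 ⟨?_, ?_⟩
      · exact (Complex.continuous_ofReal.tendsto' 0 0 (by simp)).mono_left nhdsWithin_le_nhds
      · filter_upwards [self_mem_nhdsWithin] with x hx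
        simpa using hx
    exact ht.frequently (Eventually.of_forall h).frequently
  funext z
  exact (hF.differentiableOn.analyticOnNhd
    isOpen_univ).eqOn_zero_of_preconnected_of_frequently_eq_zero isPreconnected_univ
    (Set.mem_univ 0) hfreq (Set.mem_univ z)

/-- The weight may ignore real zeros of e, so the argument is run on F·e, which vanishes
Lebesgue-almost everywhere on ℝ, hence everywhere on ℂ. The factor e has no zeros in the upper
half-plane, so F vanishes near i. -/
theorem eq_zero_of_ae_weight {e : ℂ → ℂ} (he : IsHermiteBiehler e) {n : ℕ} {F : ℂ → ℂ}
    (hF : Differentiable ℂ F) (h : ∀ᵐ x : ℝ ∂weight e n, F x = 0) : F = 0 := by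
  have h0 := ae_weight_zero he.1 n h
  rw [weight, ae_withDensity_iff (measurable_weightDensity he.1 0)] at h0
  have h1 : (fun x : ℝ => F x * e x) =ᵐ[volume] fun _ => 0 := by
    filter_upwards [h0] with x hx
    rcases eq_or_ne (e x) 0 with h2 | h2
    · simp [h2]
    · rw [hx, zero_mul]
      have : 0 < ‖e x‖ := norm_pos_iff.2 h2
      simp only [weightDensity, ne_eq, ENNReal.ofReal_eq_zero, not_le]
      positivity
  have hFe : Differentiable ℂ fun z => F z * e z := hF.mul he.1
  have h2 : (fun x : ℝ => F x * e x) = fun _ => 0 :=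
    Continuous.ae_eq_iff_eq volume (hFe.continuous.comp Complex.continuous_ofReal)
      continuous_const |>.1 h1
  have h3 := eq_zero_of_forall_ofReal hFe (congrFun h2)
  have h4 : ∀ᶠ z in 𝓝 Complex.I, F z = 0 := by
    have : ∀ᶠ z in 𝓝 Complex.I, 0 < z.im :=
      Complex.continuous_im.continuousAt.eventually (lt_mem_nhds (by simp))
    filter_upwards [this] with z hz
    exact (mul_eq_zero.1 (congrFun h3 z)).resolve_right (he.2 z hz).1
  funext z
  exact (hF.differentiableOn.analyticOnNhd
    isOpen_univ).eqOn_zero_of_preconnected_of_eventuallyEq_zero isPreconnected_univ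
    (Set.mem_univ _) h4 (Set.mem_univ z)

namespace FunctionalModel

variable {H : Type*} [NormedAddCommGroup H] [InnerProductSpace ℂ H]
  {A : H →ₗ.[ℂ] H} (M : FunctionalModel A)

theorem differentiable_Φ (φ : H) : Differentiable ℂ (M.Φ φ) := by
  have h1 : M.Φ φ ∈ deBrangesSpace M.e := by
    rw [← M.coe_Hhat]; exact LinearMap.mem_range_self _ φ
  exact h1.1

theorem weaklyContinuous : M.toXiData.WeaklyContinuous := fun φ => (M.differentiable_Φ φ).continuous

theorem exists_Φ_eq_one [CompleteSpace H] (hA : ClassS A) (z : ℂ) : ∃ k : H, M.Φ k z = 1 := by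
  have h := inner_self_ne_zero (𝕜 := ℂ).2 (M.weaklyContinuous.ξ_ne_zero hA (conj z))
  refine ⟨(inner ℂ (M.ξ (conj z)) (M.ξ (conj z)))⁻¹ • M.ξ (conj z), ?_⟩
  rw [XiData.Φ_apply, inner_smul_right, inv_mul_cancel₀ h]

/-- The function Φ(f - (Φf)(w)k) vanishes at w, so its vector is in ran(A - w). In the model this is
division by z - w inside Ĥ. -/
theorem exists_division [CompleteSpace H] (hA : ClassS A) {w : ℂ} {k : H} (hk : M.Φ k w = 1)
    (f : H) : ∃ a : A.domain, A a - w • (a : H) = f - M.Φ f w • k := by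
  refine mem_ranSub.1 ((M.weaklyContinuous.mem_ranSub_iff hA w _).2 ?_)
  simp [hk]

/-! ### Multiplication by powers of `x + i` -/

theorem eLpNorm_pow_mul_Φ_le {n j : ℕ} (hj : j ≤ n) (φ : H) :
    eLpNorm (fun x : ℝ => ((x : ℂ) + Complex.I) ^ j * M.Φ φ x) 2 (weight M.e n) ≤
      ENNReal.ofReal ‖φ‖ := by
  rw [← M.norm_Φ φ]
  refine eLpNorm_weight_le M.e_hermiteBiehler.1 fun x => ?_
  rw [norm_mul, norm_pow, mul_pow, ← pow_mul, mul_comm j, pow_mul, norm_ofReal_add_I_sq, pow_zero,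
    mul_one, mul_comm]
  gcongr
  nlinarith [sq_nonneg x]

theorem memLp_pow_mul_Φ {n j : ℕ} (hj : j ≤ n) (φ : H) :
    MemLp (fun x : ℝ => ((x : ℂ) + Complex.I) ^ j * M.Φ φ x) 2 (weight M.e n) := by
  have hc : Continuous fun x : ℝ => M.Φ φ x :=
    (M.differentiable_Φ φ).continuous.comp Complex.continuous_ofReal
  exact ⟨(by fun_prop : Continuous fun x : ℝ =>
    ((x : ℂ) + Complex.I) ^ j * M.Φ φ x).aestronglyMeasurable,
    (M.eLpNorm_pow_mul_Φ_le hj φ).trans_lt ENNReal.ofReal_lt_top⟩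

/-- `φ ↦ (x + i)ʲ (Φ φ)(x)`, as an element of `L²(dx / ((x² + 1)ⁿ |e(x)|²))`. -/
def toL2Mul (n j : ℕ) (hj : j ≤ n) : H →L[ℂ] Lp ℂ 2 (weight M.e n) :=
  LinearMap.mkContinuous
    { toFun := fun φ => (M.memLp_pow_mul_Φ hj φ).toLp _
      map_add' := fun a b => by
        rw [← MemLp.toLp_add]
        exact MemLp.toLp_congr _ _ (Eventually.of_forall fun x => by simp [mul_add])
      map_smul' := fun c a => by
        rw [RingHom.id_apply, ← MemLp.toLp_const_smul]
        exact MemLp.toLp_congr _ _ (Eventually.of_forall fun x => by simp; ring) }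
    1 (fun φ => by
      rw [one_mul]
      simp only [LinearMap.coe_mk, AddHom.coe_mk, Lp.norm_toLp]
      exact ENNReal.toReal_le_of_le_ofReal (norm_nonneg φ) (M.eLpNorm_pow_mul_Φ_le hj φ))

theorem coeFn_toL2Mul {n j : ℕ} (hj : j ≤ n) (φ : H) :
    M.toL2Mul n j hj φ =ᵐ[weight M.e n] fun x : ℝ => ((x : ℂ) + Complex.I) ^ j * M.Φ φ x :=
  MemLp.coeFn_toLp (M.memLp_pow_mul_Φ hj φ)

/-- The factor |x + i|²ⁿ = (x² + 1)ⁿ exactly cancels the extra weight. -/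
theorem norm_toL2Mul_self (n : ℕ) (φ : H) : ‖M.toL2Mul n n le_rfl φ‖ = ‖φ‖ := by
  have h : eLpNorm (fun x : ℝ => ((x : ℂ) + Complex.I) ^ n * M.Φ φ x) 2 (weight M.e n) =
      ENNReal.ofReal ‖φ‖ := by
    refine le_antisymm (M.eLpNorm_pow_mul_Φ_le le_rfl φ) ?_
    rw [← M.norm_Φ φ]
    refine eLpNorm_weight_le M.e_hermiteBiehler.1 fun x => ?_
    rw [norm_mul, norm_pow, mul_pow, ← pow_mul, mul_comm n, pow_mul, norm_ofReal_add_I_sq,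
      pow_zero, mul_one, mul_comm]
  change ‖(M.memLp_pow_mul_Φ le_rfl φ).toLp _‖ = _
  rw [Lp.norm_toLp, h, ENNReal.toReal_ofReal (norm_nonneg _)]

theorem ext_Lp {n : ℕ} {F G : Lp ℂ 2 (weight M.e n)} {f : ℝ → ℂ} (hF : F =ᵐ[weight M.e n] f)
    (hG : G =ᵐ[weight M.e n] f) : F = G :=
  Lp.ext (hF.trans hG.symm)

theorem toL2Mul_zero (n : ℕ) : M.toL2Mul n 0 (Nat.zero_le n) = M.toL2 n := by
  ext1 φ
  refine M.ext_Lp (M.coeFn_toL2Mul _ φ) ?_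
  filter_upwards [M.coeFn_toL2 n φ] with x hx
  rw [hx, pow_zero, one_mul]

/-- The closure of `Ĥ` in `L²(dx / ((x² + 1)ⁿ |e(x)|²))`. -/
def closureHhat (n : ℕ) : Submodule ℂ (Lp ℂ 2 (weight M.e n)) :=
  (LinearMap.range (M.toL2 n : H →ₗ[ℂ] Lp ℂ 2 (weight M.e n))).topologicalClosure

theorem toL2_mem_closureHhat (n : ℕ) (φ : H) : M.toL2 n φ ∈ M.closureHhat n :=
  Submodule.le_topologicalClosure _ (LinearMap.mem_range_self _ φ)

/-- For a in dom A, (x+i)ʲ⁺¹ Φa = (x+i)ʲ Φ((A+i)a), which lowers the power by one. Density of dom A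
and continuity extend this to all of H. -/
theorem toL2Mul_mem_closureHhat (hdense : Dense (A.domain : Set H)) {n j : ℕ} (hj : j ≤ n)
    (φ : H) : M.toL2Mul n j hj φ ∈ M.closureHhat n := by
  induction j generalizing φ with
  | zero => rw [toL2Mul_zero]; exact M.toL2_mem_closureHhat n φ
  | succ j ih =>
    have hcl : IsClosed {φ : H | M.toL2Mul n (j + 1) hj φ ∈ M.closureHhat n} :=
      (Submodule.isClosed_topologicalClosure _).preimage (M.toL2Mul n (j + 1) hj).continuous
    have hsub : (A.domain : Set H) ⊆ {φ : H | M.toL2Mul n (j + 1) hj φ ∈ M.closureHhat n} := by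
      intro a ha
      have h := ih (by omega) (A ⟨a, ha⟩ + Complex.I • a)
      suffices h1 : M.toL2Mul n (j + 1) hj a =
          M.toL2Mul n j (by omega) (A ⟨a, ha⟩ + Complex.I • a) from
        Set.mem_ofPred_eq ▸ h1 ▸ h
      refine M.ext_Lp (M.coeFn_toL2Mul _ _) ?_
      filter_upwards [M.coeFn_toL2Mul (by omega : j ≤ n) (A ⟨a, ha⟩ + Complex.I • a)] with x hx
      rw [hx, map_add, map_smul]
      simp only [Pi.add_apply, Pi.smul_apply, smul_eq_mul,
        M.weaklyContinuous.Φ_apply_operator ⟨a, ha⟩]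
      ring
    exact hcl.closure_subset_iff.2 hsub (hdense φ)

/-! ### Synthesis of `n`-associated functions -/

/-- The value at `z` of the function `(z + i)ⁿ (Φ g)(z) + ∑ j < n, cⱼ (z + i)ʲ (Φ k)(z)`. -/
def synth (k : H) (n : ℕ) (z : ℂ) : H × (Fin n → ℂ) →L[ℂ] ℂ :=
  ((z + Complex.I) ^ n • innerSL ℂ (M.ξ (conj z))).coprod
    (LinearMap.toContinuousLinearMap (Fintype.linearCombination ℂ
      fun j : Fin n => (z + Complex.I) ^ (j : ℕ) * M.Φ k z))

theorem synth_apply (k : H) (n : ℕ) (z : ℂ) (p : H × (Fin n → ℂ)) :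
    M.synth k n z p = (z + Complex.I) ^ n * M.Φ p.1 z +
      ∑ j : Fin n, p.2 j * ((z + Complex.I) ^ (j : ℕ) * M.Φ k z) := by
  simp [synth, XiData.Φ_apply, Fintype.linearCombination_apply]

theorem differentiable_synth (k : H) (n : ℕ) (p : H × (Fin n → ℂ)) :
    Differentiable ℂ fun z => M.synth k n z p := by
  simp only [synth_apply]
  have h1 := M.differentiable_Φ k
  have h2 := M.differentiable_Φ p.1
  fun_prop

/-- A Horner scheme in z + i, which drives every induction on n below. -/
theorem synth_succ (k : H) (n : ℕ) (z : ℂ) (g : H) (c₀ : ℂ) (c : Fin n → ℂ) :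
    M.synth k (n + 1) z (g, Fin.cons c₀ c) =
      (z + Complex.I) * M.synth k n z (g, c) + c₀ * M.Φ k z := by
  simp only [synth_apply, Fin.sum_univ_succ, Fin.cons_zero, Fin.cons_succ, Fin.val_zero, pow_zero,
    one_mul, Fin.val_succ, mul_add, Finset.mul_sum]
  have : ∀ i : Fin n, c i * ((z + Complex.I) ^ ((i : ℕ) + 1) * M.Φ k z) =
      (z + Complex.I) * (c i * ((z + Complex.I) ^ (i : ℕ) * M.Φ k z)) := fun i => by ring
  simp only [this]
  ring

/-- The same function as an element of `L²(dx / ((x² + 1)ⁿ |e(x)|²))`. -/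
def synthL2 (k : H) (n : ℕ) : H × (Fin n → ℂ) →L[ℂ] Lp ℂ 2 (weight M.e n) :=
  (M.toL2Mul n n le_rfl).coprod
    (LinearMap.toContinuousLinearMap (Fintype.linearCombination ℂ
      fun j : Fin n => M.toL2Mul n j j.2.le k))

theorem synthL2_apply (k : H) (n : ℕ) (p : H × (Fin n → ℂ)) :
    M.synthL2 k n p = M.toL2Mul n n le_rfl p.1 + ∑ j : Fin n, p.2 j • M.toL2Mul n j j.2.le k := by
  simp [synthL2, Fintype.linearCombination_apply]

theorem coeFn_synthL2 (k : H) (n : ℕ) (p : H × (Fin n → ℂ)) :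
    M.synthL2 k n p =ᵐ[weight M.e n] fun x : ℝ => M.synth k n x p := by
  rw [synthL2_apply]
  have h1 : ∀ᵐ x ∂weight M.e n, ∀ j : Fin n, (p.2 j • M.toL2Mul n j j.2.le k) x =
      p.2 j * (((x : ℂ) + Complex.I) ^ (j : ℕ) * M.Φ k x) := by
    rw [ae_all_iff]
    intro j
    filter_upwards [Lp.coeFn_smul (p.2 j) (M.toL2Mul n j j.2.le k),
      M.coeFn_toL2Mul j.2.le k] with x h2 h3
    rw [h2, Pi.smul_apply, h3, smul_eq_mul]
  filter_upwards [Lp.coeFn_add (M.toL2Mul n n le_rfl p.1)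
    (∑ j : Fin n, p.2 j • M.toL2Mul n j j.2.le k), M.coeFn_toL2Mul le_rfl p.1, h1,
    Lp.coeFn_fun_finsetSum Finset.univ fun j : Fin n => p.2 j • M.toL2Mul n j j.2.le k]
    with x h2 h3 h4 h5
  rw [h2, Pi.add_apply, h3, h5, synth_apply]
  simp only [h4]

theorem synthL2_eq_iff {k : H} {n : ℕ} {p q : H × (Fin n → ℂ)} :
    M.synthL2 k n p = M.synthL2 k n q ↔ ∀ z, M.synth k n z p = M.synth k n z q := by
  constructor
  · intro h z
    have h1 : (fun z => M.synth k n z (p - q)) = 0 := by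
      refine eq_zero_of_ae_weight (n := n) M.e_hermiteBiehler (M.differentiable_synth k n _) ?_
      have h2 : M.synthL2 k n (p - q) = 0 := by rw [map_sub, h, sub_self]
      have h3 := M.coeFn_synthL2 k n (p - q)
      rw [h2] at h3
      filter_upwards [h3, Lp.coeFn_zero ℂ 2 (weight M.e n)] with x hx hx0
      rw [← hx, hx0]; rfl
    have h4 := congrFun h1 z
    simp only [map_sub, Pi.zero_apply] at h4
    exact sub_eq_zero.1 h4
  · intro h
    refine M.ext_Lp (M.coeFn_synthL2 k n p) ?_
    filter_upwards [M.coeFn_synthL2 k n q] with x hx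
    rw [hx, h x]

/-- Evaluation at -i kills all terms but the constant coefficient. Once that is zero, divide by z +
i and use induction. -/
theorem eq_zero_of_synth_eq_zero {k : H} (hk : M.Φ k (-Complex.I) = 1) {n : ℕ}
    {p : H × (Fin n → ℂ)} (h : ∀ z, M.synth k n z p = 0) : p = 0 := by
  induction n with
  | zero =>
    have h1 : M.Φ p.1 = 0 := funext fun z => by simpa [synth_apply] using h z
    have h2 : p.1 = 0 := by
      have := M.norm_Φ p.1
      rw [h1] at this
      simpa using this.symm
    exact Prod.ext h2 (Subsingleton.elim _ _)
  | succ n ih =>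
    obtain ⟨g, c⟩ := p
    obtain ⟨c₀, c, rfl⟩ : ∃ c₀ c', c = Fin.cons c₀ c' := ⟨c 0, Fin.tail c, by simp⟩
    simp only [synth_succ] at h
    have h0 : c₀ = 0 := by simpa [hk] using h (-Complex.I)
    subst h0
    simp only [zero_mul, add_zero, mul_eq_zero] at h
    have h1 : (fun z => M.synth k n z (g, c)) = fun _ => 0 := by
      refine Continuous.ext_on (dense_compl_singleton (-Complex.I))
        (M.differentiable_synth k n (g, c)).continuous continuous_const fun z hz => ?_
      exact (h z).resolve_left fun h2 => hz (eq_neg_of_add_eq_zero_left h2)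
    have h2 := ih (congrFun h1)
    rw [Prod.mk_eq_zero] at h2
    rw [h2.1, h2.2, Prod.mk_eq_zero]
    exact ⟨rfl, by ext i; refine Fin.cases ?_ (fun i => ?_) i <;> simp⟩

theorem synthL2_injective {k : H} (hk : M.Φ k (-Complex.I) = 1) (n : ℕ) :
    Function.Injective (M.synthL2 k n) := by
  rw [injective_iff_map_eq_zero]
  intro p hp
  refine M.eq_zero_of_synth_eq_zero hk fun z => ?_
  have := M.synthL2_eq_iff.1 (hp.trans (map_zero (M.synthL2 k n)).symm) z
  rwa [map_zero] at this

/-- The range is the closed image of an isometry plus a finite-dimensional space. -/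
theorem isClosed_range_synthL2 [CompleteSpace H] (k : H) (n : ℕ) :
    IsClosed (Set.range (M.synthL2 k n)) := by
  have h1 : LinearMap.range (M.synthL2 k n : H × (Fin n → ℂ) →ₗ[ℂ] Lp ℂ 2 (weight M.e n)) =
      LinearMap.range (M.toL2Mul n n le_rfl : H →ₗ[ℂ] Lp ℂ 2 (weight M.e n)) ⊔
      LinearMap.range (Fintype.linearCombination ℂ
        fun j : Fin n => M.toL2Mul n j j.2.le k) := by
    rw [← LinearMap.range_coprod]; rfl
  have h2 : IsClosed (LinearMap.range (M.toL2Mul n n le_rfl : H →ₗ[ℂ] Lp ℂ 2 (weight M.e n)) :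
      Set (Lp ℂ 2 (weight M.e n))) :=
    (AddMonoidHomClass.isometry_of_norm (M.toL2Mul n n le_rfl)
      (M.norm_toL2Mul_self n)).isClosedEmbedding.isClosed_range
  have h3 := Submodule.isClosed_sup_finiteDimensional _ (LinearMap.range
    (Fintype.linearCombination ℂ fun j : Fin n => M.toL2Mul n j j.2.le k)) h2
  rw [← h1] at h3
  exact h3


/-- The space of the functions `z ↦ M.synth k n z p`. -/
def synthSpace (k : H) (n : ℕ) : Submodule ℂ (ℂ → ℂ) :=
  LinearMap.range (LinearMap.pi fun z => (M.synth k n z : H × (Fin n → ℂ) →ₗ[ℂ] ℂ))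

theorem mem_synthSpace {k : H} {n : ℕ} {F : ℂ → ℂ} :
    F ∈ M.synthSpace k n ↔ ∃ p, ∀ z, M.synth k n z p = F z :=
  ⟨fun ⟨p, hp⟩ => ⟨p, congrFun hp⟩, fun ⟨p, hp⟩ => ⟨p, funext hp⟩⟩

theorem Φ_mem_synthSpace_zero (k f : H) : M.Φ f ∈ M.synthSpace k 0 :=
  M.mem_synthSpace.2 ⟨(f, 0), fun z => by simp [synth_apply]⟩

theorem mem_synthSpace_succ {k : H} {n : ℕ} {F : ℂ → ℂ} :
    F ∈ M.synthSpace k (n + 1) ↔ ∃ G ∈ M.synthSpace k n, ∃ c : ℂ,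
      ∀ z, F z = (z + Complex.I) * G z + c * M.Φ k z := by
  simp only [mem_synthSpace]
  constructor
  · rintro ⟨⟨g, c⟩, h⟩
    refine ⟨fun z => M.synth k n z (g, Fin.tail c), ⟨_, fun z => rfl⟩, c 0, fun z => ?_⟩
    rw [← h, ← synth_succ, Fin.cons_self_tail]
  · rintro ⟨G, ⟨⟨g, c⟩, h⟩, c₀, hF⟩
    exact ⟨(g, Fin.cons c₀ c), fun z => by rw [synth_succ, h, hF]⟩

/-- Division at -i gives f = (A + i)a + (Φf)(-i)k, that is Φf = (z+i)Φa + (Φf)(-i)Φk. Higher n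
follows by the Horner scheme. -/
theorem synthSpace_le_succ [CompleteSpace H] (hA : ClassS A) {k : H}
    (hk : M.Φ k (-Complex.I) = 1) (n : ℕ) : M.synthSpace k n ≤ M.synthSpace k (n + 1) := by
  induction n with
  | zero =>
    intro F hF
    obtain ⟨⟨f, c⟩, hp⟩ := M.mem_synthSpace.1 hF
    obtain ⟨a, ha⟩ := M.exists_division hA hk f
    refine M.mem_synthSpace_succ.2 ⟨M.Φ a, M.Φ_mem_synthSpace_zero k a, M.Φ f (-Complex.I),
      fun z => ?_⟩
    have h1 := congrArg (fun g => M.Φ g z) ha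
    simp only [map_sub, map_smul, Pi.sub_apply, Pi.smul_apply, smul_eq_mul,
      M.weaklyContinuous.Φ_apply_operator] at h1
    have h2 := hp z
    simp only [synth_apply, pow_zero, one_mul, Finset.univ_eq_empty, Finset.sum_empty,
      add_zero] at h2
    linear_combination -h2 - h1
  | succ n ih =>
    intro F hF
    obtain ⟨G, hG, c, h⟩ := M.mem_synthSpace_succ.1 hF
    exact M.mem_synthSpace_succ.2 ⟨G, ih hG, c, h⟩

theorem synthSpace_mono [CompleteSpace H] (hA : ClassS A) {k : H}
    (hk : M.Φ k (-Complex.I) = 1) : Monotone (M.synthSpace k) :=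
  monotone_nat_of_le_succ (M.synthSpace_le_succ hA hk)

theorem mul_mem_synthSpace_succ [CompleteSpace H] (hA : ClassS A) {k : H}
    (hk : M.Φ k (-Complex.I) = 1) {n : ℕ} {F : ℂ → ℂ} (hF : F ∈ M.synthSpace k n) :
    (fun z => z * F z) ∈ M.synthSpace k (n + 1) := by
  have h1 : (fun z => (z + Complex.I) * F z) ∈ M.synthSpace k (n + 1) :=
    M.mem_synthSpace_succ.2 ⟨F, hF, 0, fun z => by simp⟩
  have h2 := Submodule.sub_mem _ h1
    (Submodule.smul_mem _ Complex.I (M.synthSpace_le_succ hA hk n hF))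
  convert h2 using 1
  funext z
  simp only [Pi.sub_apply, Pi.smul_apply, smul_eq_mul]
  ring

theorem pow_mul_Φ_mem_synthSpace [CompleteSpace H] (hA : ClassS A) {k : H}
    (hk : M.Φ k (-Complex.I) = 1) (j : ℕ) (f : H) :
    (fun z => z ^ j * M.Φ f z) ∈ M.synthSpace k j := by
  induction j with
  | zero => simpa using M.Φ_mem_synthSpace_zero k f
  | succ j ih =>
    convert M.mul_mem_synthSpace_succ hA hk ih using 1
    funext z
    ring

/-- The functions `z ↦ M.synth k n z p` are the `n`-associated functions. -/
theorem mem_synthSpace_iff [CompleteSpace H] (hA : ClassS A) {k : H}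
    (hk : M.Φ k (-Complex.I) = 1) {n : ℕ} {F : ℂ → ℂ} :
    F ∈ M.synthSpace k n ↔
      ∃ μ : Fin (n + 1) → H, ∀ z, F z = M.Φ (∑ j : Fin (n + 1), z ^ (j : ℕ) • μ j) z := by
  simp only [map_sum, map_smul, Finset.sum_apply, Pi.smul_apply, smul_eq_mul]
  constructor
  · intro hF
    induction n generalizing F with
    | zero =>
      obtain ⟨p, hp⟩ := M.mem_synthSpace.1 hF
      exact ⟨fun _ => p.1, fun z => by rw [← hp]; simp [synth_apply]⟩
    | succ n ih =>
      obtain ⟨G, hG, c, hF⟩ := M.mem_synthSpace_succ.1 hF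
      obtain ⟨μ, hμ⟩ := ih hG
      -- The product (z+i)Σ zʲΦμⱼ splits into a shifted copy of μ and i times μ. The free constant
      -- slot of the shifted copy takes the remainder ck.
      let ν : Fin (n + 2) → H := Fin.cons (c • k) μ
      let ν' : Fin (n + 2) → H := Fin.snoc (fun j => Complex.I • μ j) 0
      refine ⟨fun j => ν j + ν' j, fun z => ?_⟩
      simp only [map_add, Pi.add_apply, mul_add, Finset.sum_add_distrib]
      rw [Fin.sum_univ_succ (fun j : Fin (n + 2) => z ^ (j : ℕ) * M.Φ (ν j) z),
        Fin.sum_univ_castSucc (fun j : Fin (n + 2) => z ^ (j : ℕ) * M.Φ (ν' j) z)]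
      simp only [ν, ν', Fin.cons_zero, Fin.cons_succ, Fin.snoc_castSucc, Fin.snoc_last, map_smul,
        Pi.smul_apply, smul_eq_mul, map_zero, Pi.zero_apply, mul_zero, add_zero, Fin.val_zero,
        pow_zero, one_mul, Fin.val_succ, Fin.val_castSucc]
      rw [hF, hμ, add_mul, Finset.mul_sum, Finset.mul_sum]
      have h1 : ∀ j : Fin (n + 1), z * (z ^ (j : ℕ) * M.Φ (μ j) z) =
        z ^ ((j : ℕ) + 1) * M.Φ (μ j) z := fun j => by ring
      have h2 : ∀ j : Fin (n + 1), Complex.I * (z ^ (j : ℕ) * M.Φ (μ j) z) =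
        z ^ (j : ℕ) * (Complex.I * M.Φ (μ j) z) := fun j => by ring
      simp only [h1, h2]
      ring
  · rintro ⟨μ, hμ⟩
    have h1 : F = ∑ j : Fin (n + 1), fun z => z ^ (j : ℕ) * M.Φ (μ j) z := by
      funext z
      rw [hμ, Finset.sum_apply]
    rw [h1]
    exact Submodule.sum_mem _ fun j _ =>
      M.synthSpace_mono hA hk (Nat.lt_succ_iff.1 j.2) (M.pow_mul_Φ_mem_synthSpace hA hk j (μ j))

/-! ### Zero-free associated functions and the closure of Ĥ. -/

theorem isNEntire_iff [CompleteSpace H] (hA : ClassS A) {k : H}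
    (hk : M.Φ k (-Complex.I) = 1) (n : ℕ) :
    IsNEntire n A ↔ ∃ p, ∀ z, M.synth k n z p ≠ 0 := by
  -- Evaluation at z is a nonzero functional with kernel ran(A - z), so a line is complementary
  -- exactly when it is not in the kernel.
  have key : ∀ (z : ℂ) (m : H), IsCompl (ranSub A z) (ℂ ∙ m) ↔ M.Φ m z ≠ 0 := by
    intro z m
    have hmem := M.weaklyContinuous.mem_ranSub_iff hA z
    constructor
    · intro h h0
      have h1 : m = 0 := by
        have := h.disjoint.le_bot ⟨(hmem m).2 h0, Submodule.mem_span_singleton_self m⟩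
        simpa using this
      subst h1
      obtain ⟨f, hf⟩ := M.exists_Φ_eq_one hA z
      have h2 := h.sup_eq_top
      rw [Submodule.span_zero_singleton, sup_bot_eq] at h2
      have h3 := (hmem f).1 (h2 ▸ Submodule.mem_top)
      rw [hf] at h3
      exact one_ne_zero h3
    · intro h
      refine IsCompl.of_eq ?_ ?_
      · rw [eq_bot_iff]
        rintro f ⟨hf, hf'⟩
        obtain ⟨c, rfl⟩ := Submodule.mem_span_singleton.1 hf'
        have h1 := (hmem _).1 hf
        rw [map_smul, Pi.smul_apply, smul_eq_mul] at h1
        rw [(mul_eq_zero.1 h1).resolve_right h, zero_smul]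
        exact Submodule.zero_mem _
      · rw [eq_top_iff]
        intro f _
        refine Submodule.mem_sup.2 ⟨f - (M.Φ f z / M.Φ m z) • m, (hmem _).2 ?_,
          _, Submodule.mem_span_singleton.2 ⟨M.Φ f z / M.Φ m z, rfl⟩, sub_add_cancel _ _⟩
        simp [h]
  constructor
  · rintro ⟨-, μ, hμ⟩
    obtain ⟨p, hp⟩ := M.mem_synthSpace.1 ((M.mem_synthSpace_iff hA hk).2 ⟨μ, fun _ => rfl⟩)
    exact ⟨p, fun z => by rw [hp]; exact (key _ _).1 (hμ z)⟩
  · rintro ⟨p, hp⟩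
    obtain ⟨μ, hμ⟩ := (M.mem_synthSpace_iff hA hk).1 (M.mem_synthSpace.2 ⟨p, fun _ => rfl⟩)
    exact ⟨hA, μ, fun z => (key _ _).2 (hμ z ▸ hp z)⟩

theorem exists_synthL2_eq_toL2 [CompleteSpace H] (hA : ClassS A) {k : H}
    (hk : M.Φ k (-Complex.I) = 1) (n : ℕ) (f : H) : ∃ p, M.synthL2 k n p = M.toL2 n f := by
  obtain ⟨p, hp⟩ := M.mem_synthSpace.1
    (M.synthSpace_mono hA hk (Nat.zero_le n) (M.Φ_mem_synthSpace_zero k f))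
  refine ⟨p, M.ext_Lp (f := fun x : ℝ => M.Φ f x) ?_ (M.coeFn_toL2 n f)⟩
  filter_upwards [M.coeFn_synthL2 k n p] with x hx
  rw [hx, hp]

theorem synth_of_synthL2_eq_toL2 {k : H} {n : ℕ} {p : H × (Fin n → ℂ)} {f : H}
    (h : M.synthL2 k n p = M.toL2 n f) (z : ℂ) : M.synth k n z p = M.Φ f z := by
  have h1 : (fun z => M.synth k n z p - M.Φ f z) = 0 := by
    refine eq_zero_of_ae_weight (n := n) M.e_hermiteBiehler
      ((M.differentiable_synth k n p).sub (M.differentiable_Φ f)) ?_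
    have h3 := M.coeFn_synthL2 k n p
    rw [h] at h3
    filter_upwards [h3, M.coeFn_toL2 n f] with x hx hx0
    rw [← hx, hx0, sub_self]
  exact sub_eq_zero.1 (congrFun h1 z)

/-- The associated functions form a closed space containing Ĥ, and each of them is a limit of
elements of Ĥ because powers of x + i stay in the closure. -/
theorem range_synthL2 [CompleteSpace H] (hA : ClassS A) (hdense : Dense (A.domain : Set H)) {k : H}
    (hk : M.Φ k (-Complex.I) = 1) (n : ℕ) :
    LinearMap.range (M.synthL2 k n : H × (Fin n → ℂ) →ₗ[ℂ] Lp ℂ 2 (weight M.e n)) =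
      M.closureHhat n := by
  refine le_antisymm ?_ ?_
  · rintro _ ⟨p, rfl⟩
    change M.synthL2 k n p ∈ _
    rw [synthL2_apply]
    exact Submodule.add_mem _ (M.toL2Mul_mem_closureHhat hdense _ _)
      (Submodule.sum_mem _ fun j _ =>
        Submodule.smul_mem _ _ (M.toL2Mul_mem_closureHhat hdense _ _))
  · refine Submodule.topologicalClosure_minimal _ ?_ (M.isClosed_range_synthL2 k n)
    rintro _ ⟨f, rfl⟩
    obtain ⟨p, hp⟩ := M.exists_synthL2_eq_toL2 hA hk n f
    exact ⟨p, hp⟩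

/-! ### The space `H_{+n}` -/

section Hplus

variable [CompleteSpace H] (n : ℕ)

/-- The vector `D₀ f` of `H_{+n}`. -/
def toHplus : H →ₗ[ℂ] M.Hplus n :=
  (UniformSpace.Completion.toComplL (𝕜 := ℂ) (E := M.HplusPre n)).toLinearMap.comp
    (M.Dinv n).symm.toLinearMap

theorem toHplus_apply (f : H) :
    M.toHplus n f = (((M.Dinv n).symm f : M.HplusPre n) : M.Hplus n) := rfl

theorem denseRange_toHplus : DenseRange (M.toHplus n) := by
  have h1 : DenseRange ((↑) : M.HplusPre n → M.Hplus n) := UniformSpace.Completion.denseRange_coe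
  have h2 : Set.range (M.toHplus n) = Set.range ((↑) : M.HplusPre n → M.Hplus n) := by
    ext x
    constructor
    · rintro ⟨f, rfl⟩; exact ⟨_, rfl⟩
    · rintro ⟨g, rfl⟩; exact ⟨M.Dinv n g, by rw [toHplus_apply, LinearEquiv.symm_apply_apply]⟩
  rw [DenseRange, h2]
  exact h1

theorem incl_coe (g : M.HplusPre n) : M.incl n (g : M.Hplus n) = M.preIncl n g :=
  ContinuousLinearMap.extend_eq _ UniformSpace.Completion.denseRange_coe
    (UniformSpace.Completion.isUniformInducing_coe _) g

/-- The isometry of `H_{+n}^{pre}` into `L²(dx / ((x² + 1)ⁿ |e(x)|²))`. -/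
def preToL2 : M.HplusPre n →ₗᵢ[ℂ] Lp ℂ 2 (weight M.e n) where
  toLinearMap := (M.toL2 n : H →ₗ[ℂ] Lp ℂ 2 (weight M.e n)).comp (M.Dinv n).toLinearMap
  norm_map' g := (M.norm_pre n g).symm

/-- The isometry of `H_{+n}` into `L²(dx / ((x² + 1)ⁿ |e(x)|²))`. -/
def HplusToL2 : M.Hplus n →L[ℂ] Lp ℂ 2 (weight M.e n) :=
  (M.preToL2 n).toContinuousLinearMap.extend
    (UniformSpace.Completion.toComplL (𝕜 := ℂ) (E := M.HplusPre n))

theorem HplusToL2_coe (g : M.HplusPre n) :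
    M.HplusToL2 n (g : M.Hplus n) = M.toL2 n (M.Dinv n g) :=
  ContinuousLinearMap.extend_eq _ UniformSpace.Completion.denseRange_coe
    (UniformSpace.Completion.isUniformInducing_coe _) g

theorem HplusToL2_toHplus (f : H) : M.HplusToL2 n (M.toHplus n f) = M.toL2 n f := by
  rw [toHplus_apply, HplusToL2_coe, LinearEquiv.apply_symm_apply]

theorem norm_HplusToL2 (x : M.Hplus n) : ‖M.HplusToL2 n x‖ = ‖x‖ := by
  refine UniformSpace.Completion.induction_on x (isClosed_eq (by fun_prop) (by fun_prop)) ?_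
  intro g
  rw [HplusToL2_coe, UniformSpace.Completion.norm_coe, norm_pre]

theorem inner_HplusToL2 (x y : M.Hplus n) :
    inner ℂ (M.HplusToL2 n x) (M.HplusToL2 n y) = inner ℂ x y :=
  LinearIsometry.inner_map_map ⟨(M.HplusToL2 n).toLinearMap, M.norm_HplusToL2 n⟩ x y

theorem incl_eq_adjoint (x : M.Hplus n) :
    M.incl n x = ContinuousLinearMap.adjoint (M.toL2 n) (M.HplusToL2 n x) := by
  refine UniformSpace.Completion.induction_on x (isClosed_eq (by fun_prop) (by fun_prop)) ?_
  intro g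
  rw [incl_coe, HplusToL2_coe, ← D₀_Dinv]
  rfl

theorem inner_incl (x : M.Hplus n) (f : H) :
    inner ℂ (M.incl n x) f = inner ℂ (M.HplusToL2 n x) (M.toL2 n f) := by
  rw [incl_eq_adjoint, ContinuousLinearMap.adjoint_inner_left]

theorem range_HplusToL2 :
    LinearMap.range (M.HplusToL2 n : M.Hplus n →ₗ[ℂ] Lp ℂ 2 (weight M.e n)) =
      M.closureHhat n := by
  have hcl : IsClosed (LinearMap.range
      (M.HplusToL2 n : M.Hplus n →ₗ[ℂ] Lp ℂ 2 (weight M.e n)) :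
      Set (Lp ℂ 2 (weight M.e n))) :=
    (AddMonoidHomClass.isometry_of_norm (M.HplusToL2 n)
      (M.norm_HplusToL2 n)).isClosedEmbedding.isClosed_range
  rw [closureHhat]
  refine le_antisymm ?_ (Submodule.topologicalClosure_minimal _ ?_ hcl)
  · rintro _ ⟨x, rfl⟩
    have hcl' : IsClosed {x | M.HplusToL2 n x ∈ M.closureHhat n} :=
      (Submodule.isClosed_topologicalClosure _).preimage (M.HplusToL2 n).continuous
    refine UniformSpace.Completion.induction_on (p := fun x => M.HplusToL2 n x ∈ M.closureHhat n)
      x hcl' ?_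
    intro g
    rw [HplusToL2_coe]
    exact M.toL2_mem_closureHhat n _
  · rintro _ ⟨f, rfl⟩
    exact ⟨M.toHplus n f, M.HplusToL2_toHplus n f⟩

/-- If the image of x in H is zero, its L² representative is orthogonal to Ĥ, hence to the closure
in which it lies. -/
theorem incl_injective : Function.Injective (M.incl n) := by
  rw [injective_iff_map_eq_zero]
  intro x hx
  have h1 : ∀ y ∈ M.closureHhat n, inner ℂ (M.HplusToL2 n x) y = 0 := by
    have h2 : M.closureHhat n ≤ (ℂ ∙ M.HplusToL2 n x)ᗮ := by
      refine Submodule.topologicalClosure_minimal _ ?_ (Submodule.isClosed_orthogonal _)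
      rintro _ ⟨f, rfl⟩
      refine Submodule.mem_orthogonal_singleton_iff_inner_right.2 ?_
      change inner ℂ _ (M.toL2 n f) = 0
      rw [← inner_incl, hx, inner_zero_left]
    exact fun y hy => Submodule.mem_orthogonal_singleton_iff_inner_right.1 (h2 hy)
  have h3 := h1 (M.HplusToL2 n x) (by rw [← range_HplusToL2]; exact ⟨x, rfl⟩)
  rw [← norm_eq_zero, ← norm_HplusToL2, norm_eq_zero]
  exact inner_self_eq_zero.1 h3

/-- A vector f orthogonal to the range is in particular orthogonal to D₀f, so its weighted L² norm
vanishes. -/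
theorem denseRange_incl : DenseRange (M.incl n) := by
  have h : (LinearMap.range (M.incl n : M.Hplus n →ₗ[ℂ] H)).topologicalClosure = ⊤ := by
    rw [Submodule.topologicalClosure_eq_top_iff, eq_bot_iff]
    intro f hf
    have h1 := (Submodule.mem_orthogonal _ _).1 hf _ ⟨M.toHplus n f, rfl⟩
    change inner ℂ (M.incl n (M.toHplus n f)) f = 0 at h1
    rw [inner_incl, HplusToL2_toHplus] at h1
    exact (injective_iff_map_eq_zero _).1 (M.toL2_injective n) f (inner_self_eq_zero.1 h1)
  exact Submodule.dense_iff_topologicalClosure_eq_top.2 h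

/-- A functional on `H` that is bounded for the norm of `L²(dx / ((x² + 1)ⁿ |e(x)|²))` is the
inner product with a vector of `H_{+n}`. -/
theorem exists_incl_eq {y : H} {C : ℝ} (hC0 : 0 ≤ C)
    (hC : ∀ f, ‖(inner ℂ y f : ℂ)‖ ≤ C * ‖M.toL2 n f‖) :
    ∃ x : M.Hplus n, M.incl n x = y ∧ ‖x‖ ≤ C := by
  have hb : ∀ f, ‖(innerSL ℂ y : H →ₗ[ℂ] ℂ) f‖ ≤ C * ‖M.toHplus n f‖ := by
    intro f
    rw [← norm_HplusToL2, HplusToL2_toHplus]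
    exact hC f
  -- The functional is moved to the dense image of H in H_{+n}, extended by continuity, and
  -- represented by Riesz.
  let l := (innerSL ℂ y : H →ₗ[ℂ] ℂ).extendOfNorm (M.toHplus n)
  refine ⟨(InnerProductSpace.toDual ℂ (M.Hplus n)).symm l, ?_, ?_⟩
  · refine ext_inner_right ℂ fun f => ?_
    have h1 : l (M.toHplus n f) = inner ℂ y f :=
      LinearMap.extendOfNorm_eq (M.denseRange_toHplus n) ⟨C, hb⟩ f
    rw [inner_incl, ← HplusToL2_toHplus, inner_HplusToL2, InnerProductSpace.toDual_symm_apply, h1]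
  · rw [LinearIsometryEquiv.norm_map]
    exact LinearMap.opNorm_extendOfNorm_le (M.denseRange_toHplus n) hC0 hb

end Hplus

/-! ### Evaluation of the functions of `H_{+n}` -/

section Evaluation

variable [CompleteSpace H]

theorem exists_norm_le_synthL2 {k : H} (hk : M.Φ k (-Complex.I) = 1) (n : ℕ) :
    ∃ K : ℝ, 0 ≤ K ∧ ∀ p, ‖p‖ ≤ K * ‖M.synthL2 k n p‖ := by
  obtain ⟨K, hK⟩ := (M.synthL2 k n).antilipschitz_of_injective_of_isClosed_range
    (M.synthL2_injective hk n) (M.isClosed_range_synthL2 k n)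
  exact ⟨K, K.2, fun p => ZeroHomClass.bound_of_antilipschitz _ hK p⟩

/-- Evaluation at z̄ is bounded for the weighted norm, since the coefficients (g, c) depend
boundedly on the function. The representing vector in H_{+n} is the lift of ξ(z). -/
theorem exists_incl_eq_ξ (hA : ClassS A) (n : ℕ) (z : ℂ) :
    ∃ x : M.Hplus n, M.incl n x = M.ξ z := by
  obtain ⟨k, hk⟩ := M.exists_Φ_eq_one hA (-Complex.I)
  obtain ⟨K, hK0, hK⟩ := M.exists_norm_le_synthL2 hk n
  obtain ⟨x, hx, -⟩ := M.exists_incl_eq n (y := M.ξ z) (C := ‖M.synth k n (conj z)‖ * K)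
    (by positivity) (fun f => by
      obtain ⟨p, hp⟩ := M.exists_synthL2_eq_toL2 hA hk n f
      have h1 := M.synth_of_synthL2_eq_toL2 hp (conj z)
      rw [XiData.Φ_apply, Complex.conj_conj] at h1
      rw [← h1, ← hp, mul_assoc]
      exact (ContinuousLinearMap.le_opNorm _ _).trans
        (mul_le_mul_of_nonneg_left (hK p) (norm_nonneg _)))
  exact ⟨x, hx⟩

/-- The inner products of a vector of `H_{+n}` with the vectors over `ξ(z)` are the values of the
`n`-associated function that corresponds to it. -/
theorem inner_eq_synth (hA : ClassS A) (hdense : Dense (A.domain : Set H)) {k : H}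
    (hk : M.Φ k (-Complex.I) = 1) {n : ℕ} {z : ℂ} {x : M.Hplus n} (hx : M.incl n x = M.ξ z)
    {y : M.Hplus n} {p : H × (Fin n → ℂ)} (hp : M.synthL2 k n p = M.HplusToL2 n y) :
    inner ℂ x y = M.synth k n (conj z) p := by
  let E := (M.synthL2 k n).equivRange (M.synthL2_injective hk n) (M.isClosed_range_synthL2 k n)
  have hmem : ∀ y, M.HplusToL2 n y ∈
      LinearMap.range (M.synthL2 k n : H × (Fin n → ℂ) →ₗ[ℂ] Lp ℂ 2 (weight M.e n)) := by
    intro y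
    rw [M.range_synthL2 hA hdense hk, ← range_HplusToL2]
    exact ⟨y, rfl⟩
  -- Bounded recovery of coefficients makes both sides continuous in y, so it suffices to compare
  -- them on the dense image of H.
  let V : M.Hplus n →L[ℂ] H × (Fin n → ℂ) :=
    E.symm.toContinuousLinearMap.comp ((M.HplusToL2 n).codRestrict _ hmem)
  have hV : ∀ y, M.synthL2 k n (V y) = M.HplusToL2 n y := fun y =>
    congrArg Subtype.val (E.apply_symm_apply ⟨M.HplusToL2 n y, hmem y⟩)
  have hVp : V y = p := M.synthL2_injective hk n ((hV y).trans hp.symm)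
  have h1 : (fun y => inner ℂ x y) = fun y => M.synth k n (conj z) (V y) := by
    refine Continuous.ext_on (M.denseRange_toHplus n) (by fun_prop) (by fun_prop) ?_
    rintro _ ⟨f, rfl⟩
    have h2 := (hV (M.toHplus n f)).trans (M.HplusToL2_toHplus n f)
    change inner ℂ x (M.toHplus n f) = M.synth k n (conj z) (V (M.toHplus n f))
    rw [M.synth_of_synthL2_eq_toL2 h2, ← inner_HplusToL2, HplusToL2_toHplus, ← inner_incl, hx,
      XiData.Φ_apply, Complex.conj_conj]
  rw [← hVp]
  exact congrFun h1 y

theorem isNEntire_iff_exists_functional (hA : ClassS A) (hdense : Dense (A.domain : Set H)) {n : ℕ}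
    {ξp : ℂ → M.Hplus n} (hξp : ∀ z, M.incl n (ξp z) = M.ξ z) :
    IsNEntire n A ↔ ∃ η : M.Hminus n, ∀ z, M.bracket n (ξp z) η ≠ 0 := by
  obtain ⟨k, hk⟩ := M.exists_Φ_eq_one hA (-Complex.I)
  have hrange := (M.range_synthL2 hA hdense hk n).trans (M.range_HplusToL2 n).symm
  rw [M.isNEntire_iff hA hk]
  constructor
  · rintro ⟨p, hp⟩
    obtain ⟨y, hy⟩ : M.synthL2 k n p ∈
        LinearMap.range (M.HplusToL2 n : M.Hplus n →ₗ[ℂ] Lp ℂ 2 (weight M.e n)) :=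
      hrange ▸ ⟨p, rfl⟩
    refine ⟨(innerSLFlip ℂ y : M.Hplus n →L⋆[ℂ] ℂ), fun z => ?_⟩
    change inner ℂ (ξp z) y ≠ 0
    rw [M.inner_eq_synth hA hdense hk (hξp z) hy.symm]
    exact hp _
  · rintro ⟨η, hη⟩
    -- Conjugating the antilinear functional makes it linear, as Riesz requires. The result is η =
    -- ⟪·, y⟫.
    let l : M.Hplus n →L[ℂ] ℂ := (starL ℂ : ℂ ≃L⋆[ℂ] ℂ).toContinuousLinearMap.comp η
    let y := (InnerProductSpace.toDual ℂ (M.Hplus n)).symm l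
    have hy : ∀ x, η x = inner ℂ x y := by
      intro x
      rw [← inner_conj_symm, InnerProductSpace.toDual_symm_apply]
      simp [l]
    obtain ⟨p, hp⟩ : M.HplusToL2 n y ∈
        LinearMap.range (M.synthL2 k n : H × (Fin n → ℂ) →ₗ[ℂ] Lp ℂ 2 (weight M.e n)) :=
      hrange ▸ ⟨y, rfl⟩
    refine ⟨p, fun z => ?_⟩
    have h1 := M.inner_eq_synth hA hdense hk (hξp (conj z)) hp
    rw [Complex.conj_conj] at h1
    rw [← h1, ← hy]
    exact hη _

end Evaluation

/-! ### The space `H_{+1}` and the domain of the adjoint -/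

section Adjoint

/-- Here Φ(Aa) = xΦa and x² ≤ x² + 1: one power of the weight pays for one application of `A`. This
is why n = 1 matches dom A*. -/
theorem norm_toL2_operator_le (a : A.domain) : ‖M.toL2 1 (A a)‖ ≤ ‖(a : H)‖ := by
  change ‖(M.memLp_Φ 1 (A a)).toLp _‖ ≤ _
  rw [Lp.norm_toLp]
  refine ENNReal.toReal_le_of_le_ofReal (norm_nonneg _) ?_
  rw [← M.norm_Φ]
  refine eLpNorm_weight_le M.e_hermiteBiehler.1 fun x => ?_
  rw [M.weaklyContinuous.Φ_apply_operator, norm_mul, mul_pow, pow_zero, mul_one, pow_one,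
    Complex.norm_real, Real.norm_eq_abs, sq_abs, mul_comm]
  gcongr
  linarith

variable [CompleteSpace H]

open scoped LinearPMap

theorem norm_inner_incl_operator_le (x : M.Hplus 1) (a : A.domain) :
    ‖(inner ℂ (M.incl 1 x) (A a) : ℂ)‖ ≤ ‖x‖ * ‖(a : H)‖ := by
  rw [inner_incl, ← M.norm_HplusToL2 1 x]
  exact (norm_inner_le_norm _ _).trans
    (mul_le_mul_of_nonneg_left (M.norm_toL2_operator_le a) (norm_nonneg _))

theorem incl_mem_adjoint_domain (x : M.Hplus 1) : M.incl 1 x ∈ A†.domain := by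
  rw [LinearPMap.mem_adjoint_domain_iff]
  exact (LinearMap.mkContinuous _ ‖x‖ (M.norm_inner_incl_operator_le x)).continuous

theorem norm_adjoint_incl_le (hdense : Dense (A.domain : Set H)) (x : M.Hplus 1) :
    ‖A† ⟨M.incl 1 x, M.incl_mem_adjoint_domain x⟩‖ ≤ ‖x‖ := by
  set w := A† ⟨M.incl 1 x, M.incl_mem_adjoint_domain x⟩
  have hcl : IsClosed {f : H | ‖(inner ℂ w f : ℂ)‖ ≤ ‖x‖ * ‖f‖} :=
    isClosed_le (by fun_prop) (by fun_prop)
  have hsub : (A.domain : Set H) ⊆ {f : H | ‖(inner ℂ w f : ℂ)‖ ≤ ‖x‖ * ‖f‖} := by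
    intro a ha
    have h1 := LinearPMap.adjoint_isFormalAdjoint hdense ⟨_, M.incl_mem_adjoint_domain x⟩ ⟨a, ha⟩
    have h2 := M.norm_inner_incl_operator_le x ⟨a, ha⟩
    rw [← h1] at h2
    exact h2
  have h3 : ‖(inner ℂ w w : ℂ)‖ ≤ ‖x‖ * ‖w‖ := hcl.closure_subset_iff.2 hsub (hdense w)
  rw [inner_self_eq_norm_sq_to_K] at h3
  -- The bound on the dense domain extends to H and is then tested on w itself.
  have h4 : ‖w‖ * ‖w‖ ≤ ‖x‖ * ‖w‖ := by simpa [sq] using h3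
  by_contra h5
  push Not at h5
  nlinarith [norm_nonneg x]

/-- With f = (A + i)a + ck, both a and c are bounded by K times the weighted norm of f, and the
adjoint moves `A` from a to y. The three resulting terms give the constant (2 + ‖k‖)K. -/
theorem exists_incl_eq_of_mem_adjoint_domain (hA : ClassS A) (hdense : Dense (A.domain : Set H)) :
    ∃ K : ℝ, 0 ≤ K ∧ ∀ y : A†.domain, ∃ x : M.Hplus 1, M.incl 1 x = y ∧
      ‖x‖ ≤ K * Real.sqrt (‖(y : H)‖ ^ 2 + ‖A† y‖ ^ 2) := by
  obtain ⟨k, hk⟩ := M.exists_Φ_eq_one hA (-Complex.I)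
  obtain ⟨K, hK0, hK⟩ := M.exists_norm_le_synthL2 hk 1
  refine ⟨(2 + ‖k‖) * K, by positivity, fun y => M.exists_incl_eq 1 (by positivity) fun f => ?_⟩
  set g := Real.sqrt (‖(y : H)‖ ^ 2 + ‖A† y‖ ^ 2)
  have hy : ‖(y : H)‖ ≤ g := Real.le_sqrt_of_sq_le (le_add_of_nonneg_right (sq_nonneg _))
  have hAy : ‖A† y‖ ≤ g := Real.le_sqrt_of_sq_le (le_add_of_nonneg_left (sq_nonneg _))
  obtain ⟨a, ha⟩ := M.exists_division hA hk f
  set c := M.Φ f (-Complex.I)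
  have hf : f = A a + Complex.I • (a : H) + c • k := by
    rw [neg_smul, sub_neg_eq_add] at ha
    rw [ha, sub_add_cancel]
  have hS : M.synthL2 k 1 ((a : H), fun _ => c) = M.toL2 1 f := by
    refine M.ext_Lp (M.coeFn_synthL2 k 1 _) ?_
    filter_upwards [M.coeFn_toL2 1 f] with x hx
    rw [hx]
    nth_rewrite 1 [hf]
    simp only [map_add, map_smul, Pi.add_apply, Pi.smul_apply, smul_eq_mul,
      M.weaklyContinuous.Φ_apply_operator, synth_apply, Finset.univ_unique, Finset.sum_singleton,
      Fin.default_eq_zero, Fin.val_zero, pow_zero, pow_one]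
    ring
  have hp := hK ((a : H), fun _ => c)
  rw [hS] at hp
  have ha' : ‖(a : H)‖ ≤ K * ‖M.toL2 1 f‖ := (norm_fst_le ((a : H), fun _ : Fin 1 => c)).trans hp
  have hc' : ‖c‖ ≤ K * ‖M.toL2 1 f‖ :=
    (norm_le_pi_norm (fun _ : Fin 1 => c) 0).trans
      ((norm_snd_le ((a : H), fun _ : Fin 1 => c)).trans hp)
  have hadj : inner ℂ (y : H) (A a) = inner ℂ (A† y) (a : H) :=
    (LinearPMap.adjoint_isFormalAdjoint hdense y a).symm
  calc ‖(inner ℂ (y : H) f : ℂ)‖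
      = ‖inner ℂ (A† y) (a : H) + Complex.I * inner ℂ (y : H) (a : H) + c * inner ℂ (y : H) k‖ := by
        rw [hf, inner_add_right, inner_add_right, inner_smul_right, inner_smul_right, hadj]
    _ ≤ ‖(inner ℂ (A† y) (a : H) : ℂ)‖ + ‖(inner ℂ (y : H) (a : H) : ℂ)‖ +
        ‖c‖ * ‖(inner ℂ (y : H) k : ℂ)‖ := by
        refine (norm_add₃_le).trans_eq ?_
        rw [norm_mul, norm_mul, Complex.norm_I, one_mul]
    _ ≤ g * (K * ‖M.toL2 1 f‖) + g * (K * ‖M.toL2 1 f‖) + (K * ‖M.toL2 1 f‖) * (g * ‖k‖) := by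
        gcongr
        · exact (norm_inner_le_norm _ _).trans (by gcongr)
        · exact (norm_inner_le_norm _ _).trans (by gcongr)
        · exact (norm_inner_le_norm _ _).trans (by gcongr)
    _ = (2 + ‖k‖) * K * g * ‖M.toL2 1 f‖ := by ring

/-- Functionals transfer both ways through the bijection of H_{+1} with dom A*, bounded in each
direction. The conjugation z ↦ z̄ only relabels the points. -/
theorem isEntireGeneralized_iff (hA : ClassS A) (hdense : Dense (A.domain : Set H))
    {ξp : ℂ → M.Hplus 1} (hξp : ∀ z, M.incl 1 (ξp z) = M.ξ z) :
    IsEntireGeneralized A M.ξ ↔ ∃ η : M.Hminus 1, ∀ z, M.bracket 1 (ξp z) η ≠ 0 := by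
  constructor
  · rintro ⟨hξ, μ, ⟨C, hC⟩, hμ⟩
    let i : M.Hplus 1 →ₗ[ℂ] A†.domain :=
      (M.incl 1 : M.Hplus 1 →ₗ[ℂ] H).codRestrict A†.domain M.incl_mem_adjoint_domain
    -- The constant C is not assumed nonnegative, hence |C|.
    refine ⟨(μ.comp i).mkContinuous (|C| * Real.sqrt (‖M.incl 1‖ ^ 2 + 1)) fun x => ?_,
      fun z => ?_⟩
    · have h1 : ‖M.incl 1 x‖ ^ 2 + ‖A† (i x)‖ ^ 2 ≤ (‖M.incl 1‖ ^ 2 + 1) * ‖x‖ ^ 2 := by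
        have h2 : ‖M.incl 1 x‖ ^ 2 ≤ (‖M.incl 1‖ * ‖x‖) ^ 2 := by
          gcongr; exact (M.incl 1).le_opNorm x
        have h3 : ‖A† (i x)‖ ^ 2 ≤ ‖x‖ ^ 2 := by
          gcongr; exact M.norm_adjoint_incl_le hdense x
        nlinarith
      calc ‖μ (i x)‖ ≤ C * Real.sqrt (‖M.incl 1 x‖ ^ 2 + ‖A† (i x)‖ ^ 2) := hC (i x)
        _ ≤ |C| * Real.sqrt ((‖M.incl 1‖ ^ 2 + 1) * ‖x‖ ^ 2) := by
          gcongr; exact le_abs_self C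
        _ = |C| * Real.sqrt (‖M.incl 1‖ ^ 2 + 1) * ‖x‖ := by
          rw [Real.sqrt_mul (by positivity), Real.sqrt_sq (norm_nonneg _), mul_assoc]
    · have h1 := hμ (conj z)
      convert h1 using 2
      refine congrArg μ (Subtype.ext ?_)
      change M.incl 1 (ξp z) = M.ξ (conj (conj z))
      rw [hξp, Complex.conj_conj]
  · rintro ⟨η, hη⟩
    obtain ⟨K, hK0, hK⟩ := M.exists_incl_eq_of_mem_adjoint_domain hA hdense
    have hle : A†.domain ≤ LinearMap.range (M.incl 1 : M.Hplus 1 →ₗ[ℂ] H) := by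
      intro y hy
      obtain ⟨x, hx, -⟩ := hK ⟨y, hy⟩
      exact ⟨x, hx⟩
    let E := LinearEquiv.ofInjective (M.incl 1 : M.Hplus 1 →ₗ[ℂ] H) (M.incl_injective 1)
    let i : A†.domain →ₗ[ℂ] M.Hplus 1 := E.symm.toLinearMap.comp (Submodule.inclusion hle)
    have hi : ∀ (x : M.Hplus 1) (y : A†.domain), M.incl 1 x = y → i y = x := by
      intro x y hxy
      change E.symm _ = x
      rw [LinearEquiv.symm_apply_eq]
      exact Subtype.ext hxy.symm
    refine ⟨fun z => hξp z ▸ M.incl_mem_adjoint_domain (ξp z), η.toLinearMap.comp i,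
      ⟨‖η‖ * K, fun y => ?_⟩, fun z => ?_⟩
    · obtain ⟨x, hx, hxK⟩ := hK y
      change ‖η (i y)‖ ≤ _
      rw [hi x y hx, mul_assoc]
      exact (η.le_opNorm x).trans (mul_le_mul_of_nonneg_left hxK (norm_nonneg _))
    · change η (i _) ≠ 0
      rw [hi (ξp (conj z)) _ (hξp (conj z))]
      exact hη (conj z)

end Adjoint

end FunctionalModel

end NEntire

end

/-! ### The theorem. -/

theorem mainTheorem2 {H : Type*} [NormedAddCommGroup H] [InnerProductSpace ℂ H] [CompleteSpace H]
    (A : H →ₗ.[ℂ] H) (hA : NEntire.ClassS A) (hdense : Dense (A.domain : Set H))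
    (M : NEntire.FunctionalModel A) :
    (∀ n : ℕ,
      Function.Injective (M.incl n) ∧ DenseRange (M.incl n) ∧
      ∃ ξp : ℂ → M.Hplus n, (∀ z : ℂ, M.incl n (ξp z) = M.ξ z) ∧
        (NEntire.IsNEntire n A ↔ ∃ η : M.Hminus n, ∀ z : ℂ, M.bracket n (ξp z) η ≠ 0)) ∧
    (NEntire.IsNEntire 1 A ↔ NEntire.IsEntireGeneralized A M.ξ) := by
  refine ⟨fun n => ⟨M.incl_injective n, M.denseRange_incl n, ?_⟩, ?_⟩
  -- Injectivity of `incl` makes these lifts unique, so the choice is harmless.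
  · choose ξp hξp using M.exists_incl_eq_ξ hA n
    exact ⟨ξp, hξp, M.isNEntire_iff_exists_functional hA hdense hξp⟩
  · choose ξp hξp using M.exists_incl_eq_ξ hA 1
    rw [M.isNEntire_iff_exists_functional hA hdense hξp, M.isEntireGeneralized_iff hA hdense hξp]
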